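/- Write $\hat f(\xi)=\int f(x)e^{-2\pi i\langle\xi,x\rangle}\,dx$, extended to $L^2$. Fix $\alpha\in(1,2]$ and $K,L\in\mathbb N$ with $L\ge 10$ and $\frac{3L}{2}\le K\le 3L-2$. *Generators.* Let $m_0:\mathbb R\to\mathbb C$ be a low pass filter, i.e. a measurable $1$-periodic function with $m_0(0)=1$ and $m_0(\xi)-1=O(\xi)$ as $\xi\to0$ (for instance a trigonometric polynomial with $m_0(0)=1$), such that $$|m_0(\xi)|^2=(\cos \pi\xi)^{2K}\sum_{n=0}^{L-1}\binom{K-1+n}{n}(\sin\pi\xi)^{2n}\qquad(\xi\in\mathbb R),$$ and let $m_1$ be a measurable $1$-periodic function with $|m_1(\xi)|^2=|m_0(\xi+\tfrac12)|^2$ for all $\xi\in\mathbb R$. Then the functions $$\hat\phi(\xi)=\prod_{j=0}^\infty m_0(2^{-j}\xi)\ (\xi\in\mathbb R),\qquad \hat\psi(\xi)=m_1(4\xi_1)\hat\phi(\xi_1)\hat\phi(2\xi_2)\hat\phi(2\xi_3)\ (\xi\in\mathbb R^3)$$ are square integrable, and so define $\phi\in L^2(\mathbb R)$ and $\psi\in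 L^2(\mathbb R^3)$. On $\mathbb R^3$ put $\phi(x)=\phi(x_1)\phi(x_2)\phi(x_3)$, $\tilde\psi(x)=\psi(x_2,x_1,x_3)$ and $\breve\psi(x)=\psi(x_3,x_2,x_1)$. *Systems.* For $j\in\mathbb N_0$ and $k=(k_1,k_2)\in\mathbb Z^2$ let $A_{2^j}=\mathrm{diag}(2^{j\alpha/2},2^{j/2},2^{j/2})$, $\tilde A_{2^j}=\mathrm{diag}(2^{j/2},2^{j\alpha/2},2^{j/2})$, $\breve A_{2^j}=\mathrm{diag}(2^{j/2},2^{j/2},2^{j\alpha/2})$; let $S_k,\tilde S_k,\breve S_k$ be the $3\times3$ identity matrix with its first row replaced by $(1,k_1,k_2)$, its second row by $(k_1,1,k_2)$, and its third row by $(k_1,k_2,1)$, respectively. For $c=(c_1,c_2)$ with $c_1,c_2>0$ let $M_c=\mathrm{diag}(c_1,c_2,c_2)$, $\tilde M_c=\mathrm{diag}(c_2,c_1,c_2)$, $\breve M_c=\mathrm{diag}(c_2,c_2,c_1)$. Let $$\Psi(\psi;c,\alpha)=\{2^{j(\alpha+2)/4}\psi(S_kA_{2^j}\cdot-m): j\ge0,\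 |k_1|,|k_2|\le\lceil 2^{j(\alpha-1)/2}\rceil,\ m\in M_c\mathbb Z^3\},$$ define $\tilde\Psi(\tilde\psi;c,\alpha)$ and $\breve\Psi(\breve\psi;c,\alpha)$ in the same way with $(\tilde S_k,\tilde A_{2^j},\tilde M_c)$ and $(\breve S_k,\breve A_{2^j},\breve M_c)$, and let $$SH(\phi,\psi,\tilde\psi,\breve\psi;c,\alpha)=\{\phi(\cdot-m):m\in c_1\mathbb Z^3\}\cup\Psi(\psi;c,\alpha)\cup\tilde\Psi(\tilde\psi;c,\alpha)\cup\breve\Psi(\breve\psi;c,\alpha),$$ all of these being families indexed by their parameters. A countable family $(f_i)$ in $L^2(\mathbb R^3)$ is a frame for a subspace $V\subseteq L^2(\mathbb R^3)$ if there are $0<A\le B<\infty$ with $A\|f\|^2\le\sum_i|\langle f,f_i\rangle|^2\le B\|f\|^2$ for all $f\in V$. Let $\mathcal P=\{\xi\in\mathbb R^3:|\xi_1|\ge1,\ |\xi_2|\le|\xi_1|,\ |\xi_3|\le|\xi_1|\}$ and $\check L^2(\mathcal P)=\{f\in L^2(\mathbb R^3):\hat f=0\text{ a.e. outside }\mathcal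 P\}$. **Theorem.** There is a constant $\hat c_1>0$ such that, for all $c=(c_1,c_2)$ with $0<c_2\le c_1\le\hat c_1$, the system $\Psi(\psi;c,\alpha)$ is a frame for $\check L^2(\mathcal P)$ and the full pyramid-adapted hybrid shearlet system $SH(\phi,\psi,\tilde\psi,\breve\psi;c,\alpha)$ is a frame for $L^2(\mathbb R^3)$. -/

import Mathlib

open MeasureTheory Filter Topology Asymptotics
open scoped FourierTransform ENNReal

noncomputable section

namespace Shearlet

/-- Euclidean three-space. -/
abbrev R3 : Type := EuclideanSpace ℝ (Fin 3)

/-- The complex Hilbert space `L²(ℝ³)`. -/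
abbrev L2R3 : Type := Lp (α := R3) ℂ 2

/-! ### Frames -/

/-- The countable family `v` satisfies the two frame inequalities, with finite positive frame
bounds, for every vector of the set `V`.  The members of `v` need not lie in `V`. -/
def IsFrameOn {ι H : Type*} [NormedAddCommGroup H] [InnerProductSpace ℂ H]
    (V : Set H) (v : ι → H) : Prop :=
  Countable ι ∧ ∃ A B : ℝ, 0 < A ∧ A ≤ B ∧ ∀ f ∈ V,
    Summable (fun i => ‖inner ℂ (v i) f‖ ^ 2) ∧
    A * ‖f‖ ^ 2 ≤ ∑' i, ‖inner ℂ (v i) f‖ ^ 2 ∧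
    ∑' i, ‖inner ℂ (v i) f‖ ^ 2 ≤ B * ‖f‖ ^ 2

/-- The functions `g i` are all square integrable and their classes in `L²(ℝ³)` form a frame
for the set `V`. -/
def IsL2FrameOn {ι : Type*} (V : Set L2R3) (g : ι → R3 → ℂ) : Prop :=
  ∃ hg : ∀ i, MemLp (g i) 2 volume, IsFrameOn V (fun i => (hg i).toLp (g i))

/-- The functions `g i` form a frame for the whole of `L²(ℝ³)`. -/
def IsL2Frame {ι : Type*} (g : ι → R3 → ℂ) : Prop :=
  IsL2FrameOn Set.univ g

/-! ### The Fourier side -/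

/-- `f` is square integrable and `F` is (a representative of) its `L²` Fourier transform,
normalized by `∫ f(x) exp(-2πi⟨ξ, x⟩) dx`. -/
def HasL2Fourier {E : Type*} [NormedAddCommGroup E] [InnerProductSpace ℝ E]
    [FiniteDimensional ℝ E] [MeasurableSpace E] [BorelSpace E] (f F : E → ℂ) : Prop :=
  ∃ hf : MemLp f 2 (volume : Measure E),
    ((𝓕 (hf.toLp f) : Lp ℂ 2 (volume : Measure E)) : E → ℂ) =ᵐ[volume] F

/-- The union of the two opposite frequency pyramids around the `ξ₁`-axis. -/
def pyramid : Set R3 :=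
  {ξ | 1 ≤ ξ 0 ∧ |ξ 1 / ξ 0| ≤ 1 ∧ |ξ 2 / ξ 0| ≤ 1} ∪
  {ξ | ξ 0 ≤ -1 ∧ |ξ 1 / ξ 0| ≤ 1 ∧ |ξ 2 / ξ 0| ≤ 1}

/-- The functions in `L²(ℝ³)` whose Fourier transform vanishes almost everywhere off the
pyramid. -/
def L2Pyramid : Set L2R3 :=
  {f | ∀ᵐ ξ ∂(volume : Measure R3), ξ ∉ pyramid → (𝓕 f : L2R3) ξ = 0}

/-! ### Filters and generators -/

/-- The (measurable, `1`-periodic) transfer function of a filter. -/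
structure IsFilter (m : ℝ → ℂ) : Prop where
  measurable : Measurable m
  periodic : Function.Periodic m 1

/-- A normalized low pass filter: `m(0) = 1` and `m(ξ) - 1 = O(ξ)` at the origin, so that the
product `∏ m(2⁻ʲ ξ)` converges absolutely.  Every trigonometric polynomial with `m(0) = 1` is
one. -/
structure IsLowPassFilter (m : ℝ → ℂ) : Prop extends IsFilter m where
  map_zero : m 0 = 1
  isBigO : (fun ξ => m ξ - 1) =O[𝓝 0] (fun ξ : ℝ => ξ)

/-- The prescribed squared modulus of the low pass filter. -/
def lowPassSq (K L : ℕ) (ξ : ℝ) : ℝ :=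
  Real.cos (Real.pi * ξ) ^ (2 * K) *
    ∑ n ∈ Finset.range L, ((K - 1 + n).choose n : ℝ) * Real.sin (Real.pi * ξ) ^ (2 * n)

/-- The Fourier transform `ξ ↦ ∏_{j ≥ 0} m₀(2⁻ʲ ξ)` of the univariate scaling function. -/
def scalingHat (m₀ : ℝ → ℂ) (ξ : ℝ) : ℂ := ∏' j : ℕ, m₀ (ξ / 2 ^ j)

/-- The Fourier transform of the shearlet generator. -/
def shearletHat (m₀ m₁ : ℝ → ℂ) (ξ : R3) : ℂ :=
  m₁ (4 * ξ 0) * scalingHat m₀ (ξ 0) * scalingHat m₀ (2 * ξ 1) * scalingHat m₀ (2 * ξ 2)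

/-- The trivariate tensor product scaling function. -/
def tensor3 (φ : ℝ → ℂ) (x : R3) : ℂ := φ (x 0) * φ (x 1) * φ (x 2)

/-- `(x₁, x₂, x₃) ↦ ψ(x₂, x₁, x₃)`. -/
def swap12 (ψ : R3 → ℂ) (x : R3) : ℂ := ψ !₂[x 1, x 0, x 2]

/-- `(x₁, x₂, x₃) ↦ ψ(x₃, x₂, x₁)`. -/
def swap13 (ψ : R3 → ℂ) (x : R3) : ℂ := ψ !₂[x 2, x 1, x 0]

/-! ### Scaling, shear and sampling matrices -/

/-- The matrix `A_{2^j}`. -/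
def scale₁ (α : ℝ) (j : ℕ) : Matrix (Fin 3) (Fin 3) ℝ :=
  Matrix.diagonal ![2 ^ (j * α / 2), 2 ^ ((j : ℝ) / 2), 2 ^ ((j : ℝ) / 2)]

def scale₂ (α : ℝ) (j : ℕ) : Matrix (Fin 3) (Fin 3) ℝ :=
  Matrix.diagonal ![2 ^ ((j : ℝ) / 2), 2 ^ (j * α / 2), 2 ^ ((j : ℝ) / 2)]

def scale₃ (α : ℝ) (j : ℕ) : Matrix (Fin 3) (Fin 3) ℝ :=
  Matrix.diagonal ![2 ^ ((j : ℝ) / 2), 2 ^ ((j : ℝ) / 2), 2 ^ (j * α / 2)]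

/-- The matrix `S_k`, `k = (k₁, k₂)`. -/
def shear₁ (k : ℤ × ℤ) : Matrix (Fin 3) (Fin 3) ℝ :=
  !![1, (k.1 : ℝ), (k.2 : ℝ); 0, 1, 0; 0, 0, 1]

def shear₂ (k : ℤ × ℤ) : Matrix (Fin 3) (Fin 3) ℝ :=
  !![1, 0, 0; (k.1 : ℝ), 1, (k.2 : ℝ); 0, 0, 1]

def shear₃ (k : ℤ × ℤ) : Matrix (Fin 3) (Fin 3) ℝ :=
  !![1, 0, 0; 0, 1, 0; (k.1 : ℝ), (k.2 : ℝ), 1]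

/-- The matrix `M_c`, `c = (c₁, c₂)`. -/
def sample₁ (c₁ c₂ : ℝ) : Matrix (Fin 3) (Fin 3) ℝ := Matrix.diagonal ![c₁, c₂, c₂]

def sample₂ (c₁ c₂ : ℝ) : Matrix (Fin 3) (Fin 3) ℝ := Matrix.diagonal ![c₂, c₁, c₂]

def sample₃ (c₁ c₂ : ℝ) : Matrix (Fin 3) (Fin 3) ℝ := Matrix.diagonal ![c₂, c₂, c₁]

/-! ### Shearlet systems -/

/-- The parameters `(j, k, m)` with `j ≥ 0`, `|k₁|, |k₂| ≤ ⌈2^{j(α-1)/2}⌉` and `m ∈ ℤ³`; the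
translate belonging to `m` is the lattice point `M m`. -/
def ShearIndex (α : ℝ) : Type :=
  {p : ℕ × (ℤ × ℤ) × (Fin 3 → ℤ) //
    |p.2.1.1| ≤ ⌈(2 : ℝ) ^ (p.1 * (α - 1) / 2)⌉ ∧ |p.2.1.2| ≤ ⌈(2 : ℝ) ^ (p.1 * (α - 1) / 2)⌉}

/-- The functions `x ↦ 2^{j(α+2)/4} ψ(S_k A_{2^j} x - M m)`, with the scaling matrices `A`, the
shear matrices `S` and the sampling matrix `M` as arguments. -/
def shearSystem (α : ℝ) (A : ℕ → Matrix (Fin 3) (Fin 3) ℝ)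
    (S : ℤ × ℤ → Matrix (Fin 3) (Fin 3) ℝ) (M : Matrix (Fin 3) (Fin 3) ℝ)
    (ψ : R3 → ℂ) (p : ShearIndex α) (x : R3) : ℂ :=
  ((2 ^ (p.1.1 * (α + 2) / 4) : ℝ) : ℂ) *
    ψ (WithLp.toLp 2 ((S p.1.2.1 * A p.1.1).mulVec x.ofLp - M.mulVec (fun i => (p.1.2.2 i : ℝ))))

/-- The system `Ψ(ψ; c, α)` attached to the pyramid around the `ξ₁`-axis. -/
def shear₁System (α c₁ c₂ : ℝ) (ψ : R3 → ℂ) : ShearIndex α → R3 → ℂ :=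
  shearSystem α (scale₁ α) shear₁ (sample₁ c₁ c₂) ψ

def shear₂System (α c₁ c₂ : ℝ) (ψ : R3 → ℂ) : ShearIndex α → R3 → ℂ :=
  shearSystem α (scale₂ α) shear₂ (sample₂ c₁ c₂) ψ

def shear₃System (α c₁ c₂ : ℝ) (ψ : R3 → ℂ) : ShearIndex α → R3 → ℂ :=
  shearSystem α (scale₃ α) shear₃ (sample₃ c₁ c₂) ψ

/-- The translates `x ↦ φ(x - c₁ m)`, `m ∈ ℤ³`. -/
def scalingSystem (c₁ : ℝ) (φ : R3 → ℂ) (m : Fin 3 → ℤ) (x : R3) : ℂ :=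
  φ (WithLp.toLp 2 (fun i => x i - c₁ * m i))

/-- The pyramid-adapted hybrid shearlet system `SH(φ, ψ₁, ψ₂, ψ₃; c, α)`: the union of the
scaling translates and of the three shearlet systems, as a family. -/
def pyramidSystem (α c₁ c₂ : ℝ) (φ ψ₁ ψ₂ ψ₃ : R3 → ℂ) :
    ((Fin 3 → ℤ) ⊕ ShearIndex α ⊕ ShearIndex α ⊕ ShearIndex α) → R3 → ℂ :=
  Sum.elim (scalingSystem c₁ φ)
    (Sum.elim (shear₁System α c₁ c₂ ψ₁)
      (Sum.elim (shear₂System α c₁ c₂ ψ₂) (shear₃System α c₁ c₂ ψ₃)))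

end Shearlet

end

/-!
For each scale and shear, `∑ₘ |⟪f, fᵢ⟫|²` is the sum of the squared Fourier coefficients of
`f̂ · conj (ψ̂ ∘ N)` on a lattice, `N` being the linear map attached to the scale and shear. On the
central cell of the dual lattice Parseval's identity gives exactly `∫ |f̂|² |ψ̂ ∘ N|²`. On the other
cells `N ξ` has size at least of order `1 / c₁`, where `ψ̂` is small; Cauchy–Schwarz with weights
over the cells bounds their contribution by `O(c₁²) ∫ |f̂|² E(N ξ)` with an envelope `E`, and the
sum of `E(N ξ)` over all scales and shears is bounded because `ψ̂` vanishes to high order on the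
plane `ξ₁ = 0` (the zeros of `m₁`) and decays in every direction (the zeros of `m₀`). The sets where
`|ψ̂ ∘ N|` is bounded below cover the cone, so for small `c₁` the central cells dominate. The
scaling functions cover the low frequencies, and coordinate permutations reduce the other two cones
to the first.
-/

noncomputable section

namespace Shearlet

open scoped ComplexConjugate RealInnerProductSpace

/-! ### The `L²` Fourier transform -/

section L2Fourier

variable {E : Type*} [NormedAddCommGroup E] [InnerProductSpace ℝ E]

theorem continuous_neg_innerₗ : Continuous fun p : E × E => (-innerₗ E) p.1 p.2 := by
  simp only [LinearMap.neg_apply, innerₗ_apply_apply]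
  fun_prop

/-- The phase `ξ ↦ e^{-2πi⟨ξ, t⟩}` by which a translation by `t` acts on Fourier transforms. -/
def modulation (t ξ : E) : ℂ := Real.fourierChar (-⟪ξ, t⟫)

theorem continuous_modulation (t : E) : Continuous (modulation t) :=
  continuous_subtype_val.comp (Real.continuous_fourierChar.comp (by fun_prop))

variable [FiniteDimensional ℝ E] [MeasurableSpace E] [BorelSpace E]

theorem continuous_fourierInv {f : E → ℂ} (hf : Integrable f) : Continuous (𝓕⁻ f : E → ℂ) :=
  VectorFourier.fourierIntegral_continuous Real.continuous_fourierChar continuous_neg_innerₗ hf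

theorem integral_fourierInv_mul_eq {f g : E → ℂ} (hf : Integrable f) (hg : Integrable g) :
    ∫ x, 𝓕⁻ f x * g x = ∫ x, f x * 𝓕⁻ g x := by
  have h := VectorFourier.integral_fourierIntegral_smul_eq_flip (μ := volume) (ν := volume)
    Real.continuous_fourierChar continuous_neg_innerₗ hf hg
  have hflip : (-innerₗ E).flip = -innerₗ E := by
    ext x y
    simp [real_inner_comm]
  rw [hflip] at h
  exact h

theorem fourierInv_toLp_ae_eq {F : E → ℂ} (hF₁ : Integrable F) (hF₂ : MemLp F 2) :
    ((𝓕⁻ (hF₂.toLp F) : Lp ℂ 2 (volume : Measure E)) : E → ℂ) =ᵐ[volume] (𝓕⁻ F : E → ℂ) := by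
  refine ae_eq_of_integral_contDiff_smul_eq ((Lp.memLp _).locallyIntegrable (by norm_num))
    (continuous_fourierInv hF₁).locallyIntegrable fun g hg hgc => ?_
  have hcompact : HasCompactSupport (Complex.ofRealCLM ∘ g) := hgc.comp_left rfl
  have hsmooth : ContDiff ℝ (⊤ : ℕ∞) (Complex.ofRealCLM ∘ g) := by fun_prop
  let G := hcompact.toSchwartzMap hsmooth
  have hG : ∀ x, G x = g x := fun _ => rfl
  have hdual := congrArg (fun u => u G) (Lp.fourierInv_toTemperedDistribution_eq (hF₂.toLp F))
  simp only [TemperedDistribution.fourierInv_apply, Lp.toTemperedDistribution_apply] at hdual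
  simp only [hG, smul_eq_mul] at hdual
  simp only [Complex.real_smul]
  rw [← hdual]
  simp only [← hG]
  rw [← integral_fourierInv_mul_eq G.integrable hF₁]
  refine integral_congr_ae ?_
  filter_upwards [hF₂.coeFn_toLp] with x hx
  rw [hx, SchwartzMap.fourierInv_coe]

namespace HasL2Fourier

variable {f g F : E → ℂ}

theorem congr_left (h : HasL2Fourier f F) (hfg : g =ᵐ[volume] f) : HasL2Fourier g F := by
  obtain ⟨hf, hF⟩ := h
  have hg : MemLp g 2 := hf.ae_eq hfg.symm
  refine ⟨hg, ?_⟩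
  rwa [MemLp.toLp_congr hg hf hfg]

theorem ae_eq_fourierInv (h : HasL2Fourier f F) (hF₁ : Integrable F) (hF₂ : MemLp F 2) :
    f =ᵐ[volume] (𝓕⁻ F : E → ℂ) := by
  obtain ⟨hf, hF⟩ := h
  have hfourier : 𝓕 (hf.toLp f) = hF₂.toLp F := Lp.ext (hF.trans hF₂.coeFn_toLp.symm)
  have hinv : hf.toLp f = 𝓕⁻ (hF₂.toLp F) := by
    rw [← hfourier, FourierTransform.fourierInv_fourier_eq]
  refine hf.coeFn_toLp.symm.trans ?_
  rw [hinv]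
  exact fourierInv_toLp_ae_eq hF₁ hF₂

theorem of_fourierInv (hF₁ : Integrable F) (hF₂ : MemLp F 2) :
    HasL2Fourier (𝓕⁻ F : E → ℂ) F := by
  have hae := fourierInv_toLp_ae_eq hF₁ hF₂
  have hmem : MemLp (𝓕⁻ F : E → ℂ) 2 volume := (Lp.memLp _).ae_eq hae
  refine ⟨hmem, ?_⟩
  have htoLp : hmem.toLp _ = 𝓕⁻ (hF₂.toLp F) := Lp.ext (hmem.coeFn_toLp.trans hae.symm)
  rw [htoLp, FourierTransform.fourier_fourierInv_eq]
  exact hF₂.coeFn_toLp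

theorem const_mul (h : HasL2Fourier f F) (c : ℂ) :
    HasL2Fourier (fun x => c * f x) (fun ξ => c * F ξ) := by
  obtain ⟨hf, hF⟩ := h
  refine ⟨hf.const_mul c, ?_⟩
  have htoLp : (hf.const_mul c).toLp (fun x => c * f x) = c • hf.toLp f := rfl
  rw [htoLp, FourierTransform.fourier_smul]
  filter_upwards [Lp.coeFn_smul c (𝓕 (hf.toLp f)), hF] with ξ hξ hξ'
  rw [hξ, Pi.smul_apply, hξ', smul_eq_mul]

theorem inner_toLp (h : HasL2Fourier f F) (hf : MemLp f 2) (u : Lp ℂ 2 (volume : Measure E)) :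
    inner ℂ (hf.toLp f) u = ∫ ξ, conj (F ξ) * (𝓕 u : Lp ℂ 2 (volume : Measure E)) ξ := by
  obtain ⟨_, hF⟩ := h
  rw [← Lp.inner_fourier_eq, L2.inner_def]
  refine integral_congr_ae ?_
  filter_upwards [hF] with ξ hξ
  rw [hξ]
  simp [mul_comm]

end HasL2Fourier

theorem lintegral_fourier_enorm_sq (f : Lp ℂ 2 (volume : Measure E)) :
    ∫⁻ ξ, ‖(𝓕 f : Lp ℂ 2 (volume : Measure E)) ξ‖ₑ ^ 2 = ‖f‖ₑ ^ 2 := by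
  have h := eLpNorm_nnreal_pow_eq_lintegral (μ := (volume : Measure E)) (p := 2)
    (f := (𝓕 f : Lp ℂ 2 (volume : Measure E))) (by norm_num)
  simp only [NNReal.coe_ofNat, ENNReal.rpow_ofNat, ENNReal.coe_ofNat] at h
  rw [← h, ← Lp.enorm_def, ← ofReal_norm, Lp.norm_fourier_eq, ofReal_norm]

end L2Fourier

/-! ### Linear changes of variables -/

section LinearChange

variable {E : Type*} [NormedAddCommGroup E] [InnerProductSpace ℝ E] [FiniteDimensional ℝ E]
  {N : E →ₗ[ℝ] E}

theorem det_ne_zero_of_inner_map_map {B : E → E} (hNB : ∀ ξ x, ⟪N ξ, B x⟫ = ⟪ξ, x⟫) :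
    N.det ≠ 0 := by
  have hinj : Function.Injective N := by
    refine (injective_iff_map_eq_zero N).2 fun ξ hξ => ?_
    simpa [hξ] using (hNB ξ ξ).symm
  exact (LinearEquiv.ofInjectiveEndo N hinj).isUnit_det'.ne_zero

variable [MeasurableSpace E] [BorelSpace E]

theorem measurableEmbedding_of_det_ne_zero (hN : N.det ≠ 0) : MeasurableEmbedding N :=
  (N.equivOfDetNeZero hN).toContinuousLinearEquiv.toHomeomorph.measurableEmbedding

theorem volume_eq_smul_map_of_det_ne_zero (hN : N.det ≠ 0) :
    (volume : Measure E) = ENNReal.ofReal |N.det| • Measure.map N volume := by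
  rw [Measure.map_linearMap_addHaar_eq_smul_addHaar volume hN, smul_smul, abs_inv,
    ← ENNReal.ofReal_mul (abs_nonneg _), mul_inv_cancel₀ (abs_ne_zero.2 hN), ENNReal.ofReal_one,
    one_smul]

theorem lintegral_eq_det_mul_lintegral_comp (hN : N.det ≠ 0) (f : E → ℝ≥0∞) :
    ∫⁻ y, f y = ENNReal.ofReal |N.det| * ∫⁻ ξ, f (N ξ) := by
  conv_lhs => rw [volume_eq_smul_map_of_det_ne_zero hN]
  rw [lintegral_smul_measure, (measurableEmbedding_of_det_ne_zero hN).lintegral_map, smul_eq_mul]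

theorem integral_eq_det_mul_integral_comp (hN : N.det ≠ 0) (f : E → ℂ) :
    ∫ y, f y = (|N.det| : ℝ) * ∫ ξ, f (N ξ) := by
  conv_lhs => rw [volume_eq_smul_map_of_det_ne_zero hN]
  rw [integral_smul_measure, (measurableEmbedding_of_det_ne_zero hN).integral_map,
    ENNReal.toReal_ofReal (abs_nonneg _), Complex.real_smul]

theorem setLIntegral_eq_det_mul_setLIntegral_comp (hN : N.det ≠ 0) {s : Set E}
    (hs : MeasurableSet s) (f : E → ℝ≥0∞) :
    ∫⁻ y in s, f y = ENNReal.ofReal |N.det| * ∫⁻ ξ in N ⁻¹' s, f (N ξ) := by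
  rw [← lintegral_indicator hs, lintegral_eq_det_mul_lintegral_comp hN,
    ← lintegral_indicator (hs.preimage (measurableEmbedding_of_det_ne_zero hN).measurable)]
  rfl

theorem setIntegral_eq_det_mul_setIntegral_comp (hN : N.det ≠ 0) {s : Set E}
    (hs : MeasurableSet s) (f : E → ℂ) :
    ∫ y in s, f y = (|N.det| : ℝ) * ∫ ξ in N ⁻¹' s, f (N ξ) := by
  rw [← integral_indicator hs, integral_eq_det_mul_integral_comp hN,
    ← integral_indicator (hs.preimage (measurableEmbedding_of_det_ne_zero hN).measurable)]
  rfl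

theorem memLp_comp_of_det_ne_zero (hN : N.det ≠ 0) {f : E → ℂ} {p : ℝ≥0∞} (hf : MemLp f p) :
    MemLp (fun ξ => f (N ξ)) p := by
  refine MemLp.comp_of_map ?_ (measurableEmbedding_of_det_ne_zero hN).measurable.aemeasurable
  rw [Measure.map_linearMap_addHaar_eq_smul_addHaar volume hN]
  exact hf.smul_measure ENNReal.ofReal_ne_top

theorem memLp_modulation_mul {f : E → ℂ} {p : ℝ≥0∞} (hf : MemLp f p) (t : E) :
    MemLp (fun ξ => modulation t ξ * f ξ) p :=
  hf.mono ((continuous_modulation t).aestronglyMeasurable.mul hf.1)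
    (.of_forall fun ξ => by rw [norm_mul, modulation, Circle.norm_coe, one_mul])

theorem fourierInv_comp_linear {B : E →ₗ[ℝ] E} (hNB : ∀ ξ x, ⟪N ξ, B x⟫ = ⟪ξ, x⟫) (F : E → ℂ)
    (t x : E) :
    (𝓕⁻ (fun ξ => (|N.det| : ℝ) * (modulation t (N ξ) * F (N ξ))) : E → ℂ) x =
      (𝓕⁻ F : E → ℂ) (B x - t) := by
  rw [Real.fourierInv_eq, Real.fourierInv_eq,
    integral_eq_det_mul_integral_comp (det_ne_zero_of_inner_map_map hNB)
      (fun ξ => Real.fourierChar ⟪ξ, B x - t⟫ • F ξ), ← integral_const_mul]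
  refine integral_congr_ae (.of_forall fun ξ => ?_)
  simp only [modulation]
  rw [inner_sub_right, hNB, sub_eq_add_neg, AddChar.map_add_eq_mul]
  simp only [Circle.smul_def, smul_eq_mul, Circle.coe_mul]
  ring

/-- `N` is the contragredient of `B`. -/
theorem HasL2Fourier.comp_linear_sub {f F : E → ℂ} (h : HasL2Fourier f F) (hF₁ : Integrable F)
    (hF₂ : MemLp F 2) {B : E →ₗ[ℝ] E} (hNB : ∀ ξ x, ⟪N ξ, B x⟫ = ⟪ξ, x⟫) (t : E) :
    HasL2Fourier (fun x => f (B x - t))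
      (fun ξ => (|N.det| : ℝ) * (modulation t (N ξ) * F (N ξ))) := by
  have hN := det_ne_zero_of_inner_map_map hNB
  have hmem : ∀ {p : ℝ≥0∞}, MemLp F p →
      MemLp (fun ξ => ((|N.det| : ℝ) : ℂ) * (modulation t (N ξ) * F (N ξ))) p := fun hF =>
    (memLp_comp_of_det_ne_zero hN (memLp_modulation_mul hF t)).const_mul _
  refine (HasL2Fourier.of_fourierInv (memLp_one_iff_integrable.1
    (hmem (memLp_one_iff_integrable.2 hF₁))) (hmem hF₂)).congr_left ?_
  have hB : B.det ≠ 0 := det_ne_zero_of_inner_map_map fun x ξ => by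
    rw [real_inner_comm, hNB, real_inner_comm]
  have hquasi : Measure.QuasiMeasurePreserving (fun x => B x - t) volume volume :=
    (measurePreserving_sub_right volume t).quasiMeasurePreserving.comp
      (Measure.LinearMap.quasiMeasurePreserving volume B hB)
  filter_upwards [hquasi.ae (h.ae_eq_fourierInv hF₁ hF₂)] with x hx
  rw [hx, fourierInv_comp_linear hNB]

end LinearChange

/-! ### Parseval's identity on lattice cubes -/

section LatticeCube

variable {d : Type*}

/-- The integer point `n` as a vector of Euclidean space. -/
def latticePoint (n : d → ℤ) : EuclideanSpace ℝ d := WithLp.toLp 2 fun i => (n i : ℝ)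

/-- The half-open unit cube centred at the integer point `n`. -/
def latticeCube (n : d → ℤ) : Set (EuclideanSpace ℝ d) :=
  {u | ∀ i, u i ∈ Set.Ioc ((n i : ℝ) - 1 / 2) ((n i : ℝ) - 1 / 2 + 1)}

theorem iUnion_latticeCube : ⋃ n : d → ℤ, latticeCube n = Set.univ := by
  refine Set.eq_univ_of_forall fun u => Set.mem_iUnion.2 ⟨fun i => ⌈u i - 1 / 2⌉, fun i => ?_⟩
  have hle := Int.le_ceil (u i - 1 / 2)
  have hlt := Int.ceil_lt_add_one (u i - 1 / 2)
  constructor <;> linarith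

theorem pairwise_disjoint_latticeCube :
    Pairwise (Function.onFun Disjoint (latticeCube (d := d))) := by
  refine fun n n' hn => Set.disjoint_left.2 fun u hu hu' => hn (funext fun i => ?_)
  obtain ⟨hlt, hle⟩ := hu i
  obtain ⟨hlt', hle'⟩ := hu' i
  have h : n i < n' i + 1 := by exact_mod_cast (by linarith : (n i : ℝ) < n' i + 1)
  have h' : n' i < n i + 1 := by exact_mod_cast (by linarith : (n' i : ℝ) < n i + 1)
  omega

theorem abs_sub_le_half_of_mem_latticeCube {n : d → ℤ} {u : EuclideanSpace ℝ d}
    (hu : u ∈ latticeCube n) (i : d) : |u i - n i| ≤ 1 / 2 := by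
  obtain ⟨hlt, hle⟩ := hu i
  exact abs_le.2 ⟨by linarith, by linarith⟩

/-- The representative in `latticeCube n` of a point of the torus. -/
def torusLift (n : d → ℤ) (x : UnitAddTorus d) : EuclideanSpace ℝ d :=
  WithLp.toLp 2 (UnitAddTorus.measurableEquivPiIoc (fun i => (n i : ℝ) - 1 / 2) x).1

theorem coe_torusLift (n : d → ℤ) (x : UnitAddTorus d) :
    (fun i => (torusLift n x i : UnitAddCircle)) = x :=
  (UnitAddTorus.measurableEquivPiIoc fun i => (n i : ℝ) - 1 / 2).symm_apply_apply x

theorem measurableSet_latticeCube [Countable d] (n : d → ℤ) : MeasurableSet (latticeCube n) :=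
  measurableSet_setOfPred.2 <| Measurable.forall fun i =>
    measurableSet_setOfPred.1 <| measurableSet_Ioc.preimage (by fun_prop)

variable [Fintype d]

theorem mFourier_eq_conj_modulation (m : d → ℤ) (u : EuclideanSpace ℝ d) :
    UnitAddTorus.mFourier m (fun i => (u i : UnitAddCircle)) =
      conj (modulation (latticePoint m) u) := by
  rw [modulation, AddChar.map_neg_eq_inv, Circle.coe_inv_eq_conj, Complex.conj_conj]
  simp only [UnitAddTorus.mFourier, ContinuousMap.coe_mk, Real.fourierChar_apply,
    fourier_coe_apply, ← Complex.exp_sum, PiLp.inner_apply, latticePoint]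
  congr 1
  push_cast
  rw [Finset.mul_sum, Finset.sum_mul]
  refine Finset.sum_congr rfl fun i _ => ?_
  simp only [div_one, RCLike.inner_apply, Real.ringHom_apply, Complex.ofReal_mul,
    Complex.ofReal_intCast]
  ring

section Torus

local instance torusMeasureSpace : MeasureSpace UnitAddCircle := ⟨AddCircle.haarAddCircle⟩

theorem measurePreserving_torusLift (n : d → ℤ) :
    MeasurePreserving (torusLift n) volume (volume.restrict (latticeCube n)) :=
  ((PiLp.volume_preserving_toLp d).restrict_preimage (measurableSet_latticeCube n)).comp
    ((measurePreserving_subtype_coe (measurableSet_latticeCube n |>.preimage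
      (PiLp.volume_preserving_toLp d).measurable)).comp
      (UnitAddTorus.measurePreserving_equivPiIoc fun i => (n i : ℝ) - 1 / 2))

theorem tsum_enorm_sq_mFourierCoeff {H : UnitAddTorus d → ℂ} (hH : MemLp H 2) :
    ∑' m, ‖UnitAddTorus.mFourierCoeff H m‖ₑ ^ 2 = ∫⁻ x, ‖H x‖ₑ ^ 2 := by
  have hcoeff : UnitAddTorus.mFourierCoeff (hH.toLp H) = UnitAddTorus.mFourierCoeff H := by
    ext m
    exact integral_congr_ae (EventuallyEq.rfl.smul hH.coeFn_toLp)
  have hsum := UnitAddTorus.hasSum_sq_mFourierCoeff (hH.toLp H)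
  have hnorm : ∫ x, ‖hH.toLp H x‖ ^ 2 = ∫ x, ‖H x‖ ^ 2 :=
    integral_congr_ae (hH.coeFn_toLp.mono fun x hx => by simp only [hx])
  rw [hcoeff, hnorm] at hsum
  have hsq : ∀ z : ℂ, ‖z‖ₑ ^ 2 = ENNReal.ofReal (‖z‖ ^ 2) := fun z => by
    rw [ENNReal.ofReal_pow (norm_nonneg z), ofReal_norm]
  simp only [hsq]
  rw [← ENNReal.ofReal_tsum_of_nonneg (fun _ => by positivity) hsum.summable, hsum.tsum_eq,
    ofReal_integral_eq_lintegral_ofReal (hH.integrable_norm_pow (by norm_num))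
      (.of_forall fun _ => by positivity)]

theorem mFourierCoeff_comp_torusLift (n m : d → ℤ) {g : EuclideanSpace ℝ d → ℂ}
    (hg : AEStronglyMeasurable g (volume.restrict (latticeCube n))) :
    UnitAddTorus.mFourierCoeff (g ∘ torusLift n) (-m) =
      ∫ u in latticeCube n, conj (modulation (latticePoint m) u) * g u := by
  have hlift := measurePreserving_torusLift n
  have hmeas : AEStronglyMeasurable (fun u => conj (modulation (latticePoint m) u) * g u)
      (volume.restrict (latticeCube n)) :=
    (continuous_star.comp (continuous_modulation _)).aestronglyMeasurable.mul hg
  rw [← hlift.map_eq] at hmeas ⊢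
  rw [integral_map hlift.measurable.aemeasurable hmeas]
  refine integral_congr_ae (.of_forall fun x => ?_)
  beta_reduce
  rw [← mFourier_eq_conj_modulation, coe_torusLift, neg_neg, smul_eq_mul, Function.comp_apply]

theorem tsum_enorm_sq_integral_latticeCube (n : d → ℤ) {g : EuclideanSpace ℝ d → ℂ}
    (hg : MemLp g 2 (volume.restrict (latticeCube n))) :
    ∑' m, ‖∫ u in latticeCube n, conj (modulation (latticePoint m) u) * g u‖ₑ ^ 2 =
      ∫⁻ u in latticeCube n, ‖g u‖ₑ ^ 2 := by
  have hlift := measurePreserving_torusLift n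
  have hparseval := tsum_enorm_sq_mFourierCoeff (hg.comp_measurePreserving hlift)
  rw [← (Equiv.neg (d → ℤ)).tsum_eq] at hparseval
  simp only [Equiv.neg_apply, mFourierCoeff_comp_torusLift n _ hg.1] at hparseval
  rw [hparseval, ← hlift.map_eq, lintegral_map' _ hlift.measurable.aemeasurable]
  · rfl
  · rw [hlift.map_eq]
    exact hg.1.enorm.pow_const 2

end Torus

end LatticeCube

/-! ### Sampling the Fourier transform on a lattice -/

section Sampling

theorem tsum_sq_le_tsum_mul_tsum_sq_div {ι : Type*} (b w : ι → ℝ≥0∞) (hw₀ : ∀ i, w i ≠ 0)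
    (hw : ∀ i, w i ≠ ∞) : (∑' i, b i) ^ 2 ≤ (∑' i, w i) * ∑' i, b i ^ 2 / w i := by
  let _ : MeasurableSpace ι := ⊤
  have hholder := ENNReal.lintegral_mul_le_Lp_mul_Lq (Measure.count : Measure ι)
    Real.HolderConjugate.two_two (f := fun i => w i ^ (1 / 2 : ℝ))
    (g := fun i => b i / w i ^ (1 / 2 : ℝ)) measurable_from_top.aemeasurable
    measurable_from_top.aemeasurable
  have hmul : ∀ i, w i ^ (1 / 2 : ℝ) * (b i / w i ^ (1 / 2 : ℝ)) = b i := fun i =>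
    ENNReal.mul_div_cancel (by simp [hw₀ i, hw i]) (by simp [hw₀ i, hw i])
  have hsqrt : ∀ a : ℝ≥0∞, (a ^ (1 / 2 : ℝ)) ^ (2 : ℝ) = a := fun a => by
    rw [← ENNReal.rpow_mul]
    norm_num
  have hdiv : ∀ i, (b i / w i ^ (1 / 2 : ℝ)) ^ (2 : ℝ) = b i ^ 2 / w i := fun i => by
    rw [ENNReal.div_rpow_of_nonneg _ _ (by norm_num), hsqrt, ENNReal.rpow_two]
  simp only [lintegral_count, Pi.mul_apply, hmul, hsqrt, hdiv] at hholder
  calc (∑' i, b i) ^ 2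
      ≤ ((∑' i, w i) ^ (1 / 2 : ℝ) * (∑' i, b i ^ 2 / w i) ^ (1 / 2 : ℝ)) ^ 2 := by gcongr
    _ = (∑' i, w i) * ∑' i, b i ^ 2 / w i := by
        rw [mul_pow, ← ENNReal.rpow_two, ← ENNReal.rpow_two, hsqrt, hsqrt]

theorem tsum_enorm_sq_add_le {ι : Type*} (a b : ι → ℂ) :
    ∑' i, ‖a i + b i‖ₑ ^ 2 ≤ 2 * (∑' i, ‖a i‖ₑ ^ 2 + ∑' i, ‖b i‖ₑ ^ 2) := by
  rw [← ENNReal.tsum_add, ← ENNReal.tsum_mul_left]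
  refine ENNReal.tsum_le_tsum fun i => ?_
  have hpow := ENNReal.rpow_add_le_mul_rpow_add_rpow ‖a i‖ₑ ‖b i‖ₑ (p := 2) (by norm_num)
  rw [show (2 : ℝ) - 1 = 1 by norm_num, ENNReal.rpow_one] at hpow
  simp only [ENNReal.rpow_two] at hpow
  exact (pow_le_pow_left₀ zero_le (enorm_add_le _ _) 2).trans hpow

variable {d : Type*} {T : EuclideanSpace ℝ d →ₗ[ℝ] EuclideanSpace ℝ d}
  {g : EuclideanSpace ℝ d → ℂ} {w : (d → ℤ) → ℝ≥0∞} {D : EuclideanSpace ℝ d → ℝ≥0∞}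

theorem pairwise_disjoint_preimage_latticeCube
    (T : EuclideanSpace ℝ d →ₗ[ℝ] EuclideanSpace ℝ d) :
    Pairwise (Function.onFun Disjoint fun n : {n : d → ℤ // n ≠ 0} => T ⁻¹' latticeCube n.1) :=
  fun _ _ hn => (pairwise_disjoint_latticeCube (Subtype.coe_injective.ne hn)).preimage T

theorem iUnion_preimage_latticeCube_ne_zero
    (T : EuclideanSpace ℝ d →ₗ[ℝ] EuclideanSpace ℝ d) :
    ⋃ n : {n : d → ℤ // n ≠ 0}, T ⁻¹' latticeCube n.1 = (T ⁻¹' latticeCube 0)ᶜ := by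
  rw [← Set.preimage_iUnion, ← Set.preimage_compl]
  congr 1
  refine Set.Subset.antisymm (Set.iUnion_subset fun n => ?_) fun u hu => ?_
  · exact Set.disjoint_left.1 (pairwise_disjoint_latticeCube n.2)
  · obtain ⟨n, hn⟩ := Set.mem_iUnion.1 (iUnion_latticeCube.symm ▸ Set.mem_univ u)
    exact Set.mem_iUnion.2 ⟨⟨n, fun hzero => hu (hzero ▸ hn)⟩, hn⟩

theorem measurableSet_preimage_latticeCube [Finite d]
    (T : EuclideanSpace ℝ d →ₗ[ℝ] EuclideanSpace ℝ d) (n : d → ℤ) :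
    MeasurableSet (T ⁻¹' latticeCube n) := by
  cases nonempty_fintype d
  exact (measurableSet_latticeCube n).preimage T.continuous_of_finiteDimensional.measurable

variable [Fintype d]

/-- The function whose integral is the coefficient of `g` at the lattice point `m`, for the
lattice that `T` maps to the integer points. -/
def sampled (T : EuclideanSpace ℝ d →ₗ[ℝ] EuclideanSpace ℝ d) (g : EuclideanSpace ℝ d → ℂ)
    (m : d → ℤ) (ξ : EuclideanSpace ℝ d) : ℂ :=
  conj (modulation (latticePoint m) (T ξ)) * g ξ

theorem integrable_sampled (hg : Integrable g) (m : d → ℤ) : Integrable (sampled T g m) :=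
  hg.mono (((Complex.continuous_conj.comp (continuous_modulation _)).comp
    T.continuous_of_finiteDimensional).aestronglyMeasurable.mul hg.1)
    (.of_forall fun ξ => by
      rw [sampled, norm_mul, RCLike.norm_conj, modulation, Circle.norm_coe, one_mul])

theorem det_mul_tsum_enorm_sq_setIntegral_sampled (hT : T.det ≠ 0) (hg : MemLp g 2) (n : d → ℤ) :
    ENNReal.ofReal |T.det| * ∑' m, ‖∫ ξ in T ⁻¹' latticeCube n, sampled T g m ξ‖ₑ ^ 2 =
      ∫⁻ ξ in T ⁻¹' latticeCube n, ‖g ξ‖ₑ ^ 2 := by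
  set e := T.equivOfDetNeZero hT
  have heT : ∀ ξ, e.symm (T ξ) = ξ := e.symm_apply_apply
  have hsymm : LinearMap.det (e.symm : EuclideanSpace ℝ d →ₗ[ℝ] EuclideanSpace ℝ d) ≠ 0 :=
    e.symm.isUnit_det'.ne_zero
  have hparseval := tsum_enorm_sq_integral_latticeCube n
    ((memLp_comp_of_det_ne_zero hsymm hg).restrict (latticeCube n))
  have hcube := measurableSet_latticeCube n
  have henorm : ‖((|T.det| : ℝ) : ℂ)‖ₑ = ENNReal.ofReal |T.det| := by
    rw [← ofReal_norm, Complex.norm_real, Real.norm_eq_abs, abs_abs]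
  simp only [setIntegral_eq_det_mul_setIntegral_comp hT hcube, LinearEquiv.coe_coe,
    setLIntegral_eq_det_mul_setLIntegral_comp hT hcube, heT, enorm_mul, mul_pow,
    henorm, ENNReal.tsum_mul_left] at hparseval
  have hdet : ENNReal.ofReal |T.det| ≠ 0 := by simpa using hT
  rw [sq, mul_assoc] at hparseval
  exact (ENNReal.mul_right_inj hdet ENNReal.ofReal_ne_top).1 hparseval

theorem enorm_sq_setIntegral_compl_sampled_le (hg : Integrable g) (hw₀ : ∀ n, w n ≠ 0)
    (hw : ∀ n, w n ≠ ∞) (m : d → ℤ) :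
    ‖∫ ξ in (T ⁻¹' latticeCube 0)ᶜ, sampled T g m ξ‖ₑ ^ 2 ≤
      (∑' n, w n) * ∑' n : {n : d → ℤ // n ≠ 0},
        ‖∫ ξ in T ⁻¹' latticeCube n.1, sampled T g m ξ‖ₑ ^ 2 / w n := by
  have hsum : ∫ ξ in (T ⁻¹' latticeCube 0)ᶜ, sampled T g m ξ =
      ∑' n : {n : d → ℤ // n ≠ 0}, ∫ ξ in T ⁻¹' latticeCube n.1, sampled T g m ξ := by
    rw [← iUnion_preimage_latticeCube_ne_zero]
    exact integral_iUnion (fun n => measurableSet_preimage_latticeCube T n.1)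
      (pairwise_disjoint_preimage_latticeCube T) (integrable_sampled hg m).integrableOn
  rw [hsum]
  refine (pow_le_pow_left₀ zero_le enorm_tsum_le_tsum_enorm 2).trans
    ((tsum_sq_le_tsum_mul_tsum_sq_div _ (fun n : {n : d → ℤ // n ≠ 0} => w n) (fun n => hw₀ n)
      fun n => hw n).trans ?_)
  gcongr
  exact ENNReal.tsum_comp_le_tsum_of_injective Subtype.coe_injective w

theorem tsum_setLIntegral_preimage_latticeCube_le
    (T : EuclideanSpace ℝ d →ₗ[ℝ] EuclideanSpace ℝ d) (D : EuclideanSpace ℝ d → ℝ≥0∞) :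
    ∑' n : {n : d → ℤ // n ≠ 0}, ∫⁻ ξ in T ⁻¹' latticeCube n.1, D ξ ≤ ∫⁻ ξ, D ξ := by
  have hunion := lintegral_iUnion (μ := volume)
    (fun n : {n : d → ℤ // n ≠ 0} => measurableSet_preimage_latticeCube T n.1)
    (pairwise_disjoint_preimage_latticeCube T) D
  exact hunion.symm.le.trans (setLIntegral_le_lintegral _ _)

theorem det_mul_tsum_enorm_sq_setIntegral_compl_sampled_le (hT : T.det ≠ 0) (hg₁ : Integrable g)
    (hg₂ : MemLp g 2) (hw₀ : ∀ n, w n ≠ 0) (hw : ∀ n, w n ≠ ∞)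
    (hD : ∀ n ≠ 0, ∀ ξ, T ξ ∈ latticeCube n → ‖g ξ‖ₑ ^ 2 ≤ w n * D ξ) :
    ENNReal.ofReal |T.det| * ∑' m, ‖∫ ξ in (T ⁻¹' latticeCube 0)ᶜ, sampled T g m ξ‖ₑ ^ 2 ≤
      (∑' n, w n) * ∫⁻ ξ, D ξ := by
  have hcube : ∀ n : {n : d → ℤ // n ≠ 0},
      (∫⁻ ξ in T ⁻¹' latticeCube n.1, ‖g ξ‖ₑ ^ 2) / w n ≤
        ∫⁻ ξ in T ⁻¹' latticeCube n.1, D ξ := fun n => by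
    refine ENNReal.div_le_of_le_mul' ?_
    rw [← lintegral_const_mul' _ _ (hw n)]
    exact setLIntegral_mono' (measurableSet_preimage_latticeCube T n.1) (hD n n.2)
  calc ENNReal.ofReal |T.det| * ∑' m, ‖∫ ξ in (T ⁻¹' latticeCube 0)ᶜ, sampled T g m ξ‖ₑ ^ 2
      ≤ ENNReal.ofReal |T.det| * ∑' m, (∑' n, w n) * ∑' n : {n : d → ℤ // n ≠ 0},
          ‖∫ ξ in T ⁻¹' latticeCube n.1, sampled T g m ξ‖ₑ ^ 2 / w n := by
        gcongr with m
        exact enorm_sq_setIntegral_compl_sampled_le hg₁ hw₀ hw m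
    _ = (∑' n, w n) * ∑' n : {n : d → ℤ // n ≠ 0},
          (∫⁻ ξ in T ⁻¹' latticeCube n.1, ‖g ξ‖ₑ ^ 2) / w n := by
        simp only [← det_mul_tsum_enorm_sq_setIntegral_sampled hT hg₂, ENNReal.div_eq_inv_mul,
          ENNReal.tsum_mul_left]
        rw [mul_left_comm, ENNReal.tsum_comm, ← ENNReal.tsum_mul_left]
        simp only [ENNReal.tsum_mul_left, mul_left_comm]
    _ ≤ (∑' n, w n) * ∑' n : {n : d → ℤ // n ≠ 0}, ∫⁻ ξ in T ⁻¹' latticeCube n.1, D ξ := by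
        gcongr with n
        exact hcube n
    _ ≤ (∑' n, w n) * ∫⁻ ξ, D ξ := by
        gcongr
        exact tsum_setLIntegral_preimage_latticeCube_le T D

/-- The sum of the squared coefficients of `g`, normalized so that it equals `‖g‖²` when `g`
is supported in the cell `T ⁻¹' latticeCube 0`. -/
def latticeEnergy (T : EuclideanSpace ℝ d →ₗ[ℝ] EuclideanSpace ℝ d)
    (g : EuclideanSpace ℝ d → ℂ) : ℝ≥0∞ :=
  ENNReal.ofReal |T.det| * ∑' m, ‖∫ ξ, sampled T g m ξ‖ₑ ^ 2

theorem latticeEnergy_le (hT : T.det ≠ 0) (hg₁ : Integrable g) (hg₂ : MemLp g 2)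
    (hw₀ : ∀ n, w n ≠ 0) (hw : ∀ n, w n ≠ ∞)
    (hD : ∀ n ≠ 0, ∀ ξ, T ξ ∈ latticeCube n → ‖g ξ‖ₑ ^ 2 ≤ w n * D ξ) :
    latticeEnergy T g ≤
      2 * ((∫⁻ ξ in T ⁻¹' latticeCube 0, ‖g ξ‖ₑ ^ 2) + (∑' n, w n) * ∫⁻ ξ, D ξ) := by
  have hsplit : ∀ m, (∫ ξ in T ⁻¹' latticeCube 0, sampled T g m ξ) +
      ∫ ξ in (T ⁻¹' latticeCube 0)ᶜ, sampled T g m ξ = ∫ ξ, sampled T g m ξ := fun m =>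
    integral_add_compl (measurableSet_preimage_latticeCube T 0) (integrable_sampled hg₁ m)
  have hremainder := det_mul_tsum_enorm_sq_setIntegral_compl_sampled_le hT hg₁ hg₂ hw₀ hw hD
  simp only [latticeEnergy, ← hsplit]
  refine (mul_le_mul_right (tsum_enorm_sq_add_le _ _) _).trans ?_
  rw [mul_left_comm, mul_add, det_mul_tsum_enorm_sq_setIntegral_sampled hT hg₂]
  gcongr

theorem lintegral_preimage_latticeCube_le (hT : T.det ≠ 0) (hg₁ : Integrable g) (hg₂ : MemLp g 2)
    (hw₀ : ∀ n, w n ≠ 0) (hw : ∀ n, w n ≠ ∞)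
    (hD : ∀ n ≠ 0, ∀ ξ, T ξ ∈ latticeCube n → ‖g ξ‖ₑ ^ 2 ≤ w n * D ξ) :
    ∫⁻ ξ in T ⁻¹' latticeCube 0, ‖g ξ‖ₑ ^ 2 ≤
      2 * (latticeEnergy T g + (∑' n, w n) * ∫⁻ ξ, D ξ) := by
  have hsplit : ∀ m, ∫ ξ in T ⁻¹' latticeCube 0, sampled T g m ξ =
      (∫ ξ, sampled T g m ξ) + -∫ ξ in (T ⁻¹' latticeCube 0)ᶜ, sampled T g m ξ := fun m => by
    rw [← integral_add_compl (measurableSet_preimage_latticeCube T 0) (integrable_sampled hg₁ m),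
      add_neg_cancel_right]
  have hremainder := det_mul_tsum_enorm_sq_setIntegral_compl_sampled_le hT hg₁ hg₂ hw₀ hw hD
  rw [← det_mul_tsum_enorm_sq_setIntegral_sampled hT hg₂]
  simp only [hsplit]
  refine (mul_le_mul_right (tsum_enorm_sq_add_le _ _) _).trans ?_
  simp only [enorm_neg]
  rw [mul_left_comm, mul_add]
  gcongr
  exact le_rfl

end Sampling

/-! ### Quadratically decaying weights -/

/-- The quadratically decaying profile that dominates all the univariate factors. -/
def decay (x : ℝ) : ℝ := (1 + x ^ 2)⁻¹

theorem decay_pos (x : ℝ) : 0 < decay x := by unfold decay; positivity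

theorem decay_le_one (x : ℝ) : decay x ≤ 1 :=
  inv_le_one_of_one_le₀ (by nlinarith [sq_nonneg x])

theorem decay_le_decay_of_abs_le {x y : ℝ} (h : |x| ≤ |y|) : decay y ≤ decay x :=
  inv_anti₀ (by positivity) (by gcongr 1 + ?_; exact sq_le_sq.2 h)

theorem sq_mul_decay_le_one (x : ℝ) : x ^ 2 * decay x ≤ 1 := by
  unfold decay
  rw [← div_eq_mul_inv, div_le_one (by positivity)]
  linarith

theorem integrable_decay : Integrable decay := integrable_inv_one_add_sq

theorem summable_decay_int : Summable fun n : ℤ => decay n := by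
  refine (Real.summable_one_div_int_pow.2 one_lt_two).of_norm_bounded_eventually ?_
  filter_upwards [(Set.finite_singleton (0 : ℤ)).compl_mem_cofinite] with n hn
  have hn' : (n : ℝ) ≠ 0 := by exact_mod_cast hn
  rw [Real.norm_of_nonneg (decay_pos _).le, one_div]
  exact inv_anti₀ (by positivity) (by linarith)

theorem decay_mul_le_of_ne_zero {n : ℤ} (hn : n ≠ 0) {t y : ℝ} (hy : y ≠ 0)
    (ht : |t - n| ≤ 1 / 2) : decay (y * t) ≤ (y ^ 2)⁻¹ * (8 * decay n) := by
  have one_le_abs : (1 : ℝ) ≤ |(n : ℝ)| := by exact_mod_cast Int.one_le_abs hn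
  have half_le : |(n : ℝ)| / 2 ≤ |t| := by
    linarith [abs_sub_abs_le_abs_sub (n : ℝ) t, abs_sub_comm t n]
  have quarter_le : (n : ℝ) ^ 2 / 4 ≤ t ^ 2 := by
    rw [← sq_abs (n : ℝ), ← sq_abs t]
    nlinarith
  have one_le_sq : (1 : ℝ) ≤ n ^ 2 := one_le_sq_iff_one_le_abs _ |>.2 one_le_abs
  have : 0 < y ^ 2 := by positivity
  unfold decay
  rw [← div_eq_mul_inv 8, ← one_div, ← one_div, div_mul_div_comm, one_mul,
    div_le_div_iff₀ (by positivity) (by positivity)]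
  nlinarith

theorem decay_mul_le {t y : ℝ} (hy : y ≠ 0) {n : ℤ} (ht : |t - n| ≤ 1 / 2) :
    decay (y * t) ≤ (1 + (y ^ 2)⁻¹) * (8 * decay n) := by
  have hy2 : 0 < (y ^ 2)⁻¹ := by positivity
  have hd := decay_pos n
  rcases eq_or_ne n 0 with rfl | hn
  · refine (decay_le_one _).trans ?_
    simp only [decay, Int.cast_zero, ne_eq, OfNat.ofNat_ne_zero, not_false_eq_true, zero_pow,
      add_zero, inv_one, mul_one]
    linarith
  · refine (decay_mul_le_of_ne_zero hn hy ht).trans ?_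
    gcongr
    linarith

theorem decay_le_sq_mul_decay {n : ℤ} (hn : n ≠ 0) {c η : ℝ} (hc : 0 < c)
    (h : |c * η - n| ≤ 1 / 2) : decay η ≤ c ^ 2 * (8 * decay n) := by
  simpa [hc.ne'] using decay_mul_le_of_ne_zero hn (inv_ne_zero hc.ne') h

theorem decay_le_eight_mul_decay {n : ℤ} {c η : ℝ} (hc : 0 < c) (hc₁ : c ≤ 1)
    (h : |c * η - n| ≤ 1 / 2) : decay η ≤ 8 * decay n := by
  rcases eq_or_ne n 0 with rfl | hn
  · exact (decay_le_one η).trans (by norm_num [decay])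
  · refine (decay_le_sq_mul_decay hn hc h).trans (mul_le_of_le_one_left ?_ (pow_le_one₀ hc.le hc₁))
    exact mul_nonneg (by norm_num) (decay_pos _).le

/-- The sum `∑ 8 (1 + n²)⁻¹` over the integers, by which all the lattice sums are bounded. -/
def decaySum : ℝ≥0∞ := ∑' n : ℤ, ENNReal.ofReal (8 * decay n)

theorem decaySum_ne_top : decaySum ≠ ∞ := by
  rw [decaySum, ← ENNReal.ofReal_tsum_of_nonneg
    (fun n => mul_nonneg (by norm_num) (decay_pos _).le) (summable_decay_int.mul_left 8)]
  exact ENNReal.ofReal_ne_top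

section LatticeWeight

variable {d : Type*} [Fintype d]

/-- The product weight `∏ 8 (1 + nᵢ²)⁻¹` on `ℤᵈ`. -/
def latticeWeight (n : d → ℤ) : ℝ≥0∞ := ∏ i, ENNReal.ofReal (8 * decay (n i))

theorem latticeWeight_ne_zero (n : d → ℤ) : latticeWeight n ≠ 0 :=
  Finset.prod_ne_zero_iff.2 fun i _ =>
    (ENNReal.ofReal_pos.2 (mul_pos (by norm_num) (decay_pos (n i)))).ne'

theorem latticeWeight_ne_top (n : d → ℤ) : latticeWeight n ≠ ∞ :=
  ENNReal.prod_ne_top fun _ _ => ENNReal.ofReal_ne_top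

theorem tsum_prod_le_tsum_pow {κ : Type*} (w : κ → ℝ≥0∞) :
    ∑' n : d → κ, ∏ i, w (n i) ≤ (∑' k, w k) ^ Fintype.card d := by
  classical
  rw [ENNReal.tsum_eq_iSup_sum]
  refine iSup_le fun s => ?_
  calc ∑ n ∈ s, ∏ i, w (n i)
      ≤ ∑ n ∈ Fintype.piFinset fun i => s.image fun n => n i, ∏ i, w (n i) :=
        Finset.sum_le_sum_of_subset fun n hn =>
          Fintype.mem_piFinset.2 fun i => Finset.mem_image_of_mem _ hn
    _ = ∏ i, ∑ k ∈ s.image fun n => n i, w k := (Finset.prod_univ_sum _ _).symm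
    _ ≤ ∏ _i : d, ∑' k, w k := Finset.prod_le_prod' fun i _ => ENNReal.sum_le_tsum _
    _ = (∑' k, w k) ^ Fintype.card d := by rw [Finset.prod_const, Finset.card_univ]

theorem tsum_latticeWeight_ne_top : ∑' n : d → ℤ, latticeWeight n ≠ ∞ :=
  ne_top_of_le_ne_top (ENNReal.pow_ne_top decaySum_ne_top) (tsum_prod_le_tsum_pow _)

/-- On a cube `n ≠ 0` at least one coordinate of the scaled lattice point is nonzero, and that
coordinate yields the gain `c₀²` of a fine sampling. -/
theorem prod_decay_le_sq_mul_latticeWeight {n : d → ℤ} (hn : n ≠ 0) {c η : d → ℝ} {c₀ : ℝ}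
    (hc : ∀ i, 0 < c i) (hcc₀ : ∀ i, c i ≤ c₀) (hc₀ : c₀ ≤ 1)
    (h : ∀ i, |c i * η i - n i| ≤ 1 / 2) :
    ENNReal.ofReal (∏ i, decay (η i)) ≤ ENNReal.ofReal (c₀ ^ 2) * latticeWeight n := by
  classical
  obtain ⟨i, hi⟩ := Function.ne_iff.1 hn
  have decay_i : decay (η i) ≤ c₀ ^ 2 * (8 * decay (n i)) := by
    refine (decay_le_sq_mul_decay hi (hc i) (h i)).trans ?_
    have := decay_pos (n i)
    gcongr
    exacts [(hc i).le, hcc₀ i]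
  rw [latticeWeight, ENNReal.ofReal_prod_of_nonneg fun _ _ => (decay_pos _).le,
    ← Finset.mul_prod_erase _ _ (Finset.mem_univ i), ← Finset.mul_prod_erase _ _
    (Finset.mem_univ i), ← mul_assoc, ← ENNReal.ofReal_mul (sq_nonneg _)]
  exact mul_le_mul' (ENNReal.ofReal_le_ofReal decay_i) (Finset.prod_le_prod' fun j _ =>
    ENNReal.ofReal_le_ofReal (decay_le_eight_mul_decay (hc j) ((hcc₀ j).trans hc₀) (h j)))

end LatticeWeight

/-! ### Sums over shears and scales -/

theorem tsum_decay_sub_mul_le (x : ℝ) {y : ℝ} (hy : y ≠ 0) :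
    ∑' k : ℤ, ENNReal.ofReal (decay (x - k * y)) ≤
      ENNReal.ofReal (1 + (y ^ 2)⁻¹) * decaySum := by
  rw [decaySum, ← ENNReal.tsum_mul_left, ← (Equiv.subLeft (round (x / y))).tsum_eq
    (fun n : ℤ => ENNReal.ofReal (1 + (y ^ 2)⁻¹) * ENNReal.ofReal (8 * decay n))]
  refine ENNReal.tsum_le_tsum fun k => ?_
  have close : |x / y - k - (round (x / y) - k : ℤ)| ≤ 1 / 2 := by
    simpa using abs_sub_round (x / y)
  rw [← ENNReal.ofReal_mul (by positivity),
    show x - k * y = y * (x / y - k) by field_simp]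
  exact ENNReal.ofReal_le_ofReal (decay_mul_le hy close)

/-- The scale sum telescopes for the bounded function `y²(1 + y²)⁻¹`. -/
theorem sq_mul_decay_sq_le_sub {ρ : ℝ} (hρ : ρ ^ 2 < 1) (y : ℝ) :
    y ^ 2 * decay y ^ 2 ≤
      (1 - ρ ^ 2)⁻¹ * (y ^ 2 * decay y - (ρ * y) ^ 2 * decay (ρ * y)) := by
  have hρ' : 0 < 1 - ρ ^ 2 := by linarith
  have sub_eq : y ^ 2 * decay y - (ρ * y) ^ 2 * decay (ρ * y) =
      (1 - ρ ^ 2) * (y ^ 2 * (decay y * decay (ρ * y))) := by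
    unfold decay
    field_simp
    ring
  have mono : decay y ≤ decay (ρ * y) := decay_le_decay_of_abs_le <| by
    rw [abs_mul]
    exact mul_le_of_le_one_left (abs_nonneg y) (abs_le_one_iff_mul_self_le_one.2 (by nlinarith))
  rw [sub_eq, inv_mul_cancel_left₀ hρ'.ne', sq (decay y)]
  have := decay_pos y
  gcongr

theorem tsum_sq_mul_decay_sq_le {ρ : ℝ} (hρ : ρ ^ 2 < 1) (x : ℝ) :
    ∑' j : ℕ, ENNReal.ofReal ((ρ ^ j * x) ^ 2 * decay (ρ ^ j * x) ^ 2) ≤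
      ENNReal.ofReal (1 - ρ ^ 2)⁻¹ := by
  have hρ' : 0 < (1 - ρ ^ 2)⁻¹ := inv_pos.2 (by linarith)
  refine ENNReal.tsum_le_of_sum_range_le fun n => ?_
  rw [← ENNReal.ofReal_sum_of_nonneg fun j _ => by positivity]
  apply ENNReal.ofReal_le_ofReal
  set g : ℕ → ℝ := fun j => (ρ ^ j * x) ^ 2 * decay (ρ ^ j * x) with hg
  have g_nonneg : 0 ≤ g n := mul_nonneg (sq_nonneg _) (decay_pos _).le
  have g_le_one : g 0 ≤ 1 := sq_mul_decay_le_one _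
  calc ∑ j ∈ Finset.range n, (ρ ^ j * x) ^ 2 * decay (ρ ^ j * x) ^ 2
      ≤ ∑ j ∈ Finset.range n, (1 - ρ ^ 2)⁻¹ * (g j - g (j + 1)) := by
        refine Finset.sum_le_sum fun j _ => ?_
        simpa only [hg, pow_succ', mul_assoc] using sq_mul_decay_sq_le_sub hρ (ρ ^ j * x)
    _ = (1 - ρ ^ 2)⁻¹ * (g 0 - g n) := by rw [← Finset.mul_sum, Finset.sum_range_sub']
    _ ≤ (1 - ρ ^ 2)⁻¹ := mul_le_of_le_one_right hρ'.le (by linarith)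

/-- The majorant of the squared Fourier transform of the shearlet generator whose sum over all
scales and shears is bounded. -/
def majorant (η : Fin 3 → ℝ) : ℝ := η 0 ^ 6 * decay (η 0) ^ 4 * decay (η 1) * decay (η 2)

theorem majorant_nonneg (η : Fin 3 → ℝ) : 0 ≤ majorant η := by
  have h (i : Fin 3) := decay_pos (η i)
  exact mul_nonneg (mul_nonneg (mul_nonneg (by positivity) (pow_nonneg (h 0).le 4)) (h 1).le)
    (h 2).le

theorem tsum_majorant_shear_le (y x₁ x₂ : ℝ) :
    ∑' k : ℤ × ℤ, ENNReal.ofReal (majorant ![y, x₁ - k.1 * y, x₂ - k.2 * y]) ≤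
      ENNReal.ofReal (y ^ 2 * decay y ^ 2) * decaySum ^ 2 := by
  rcases eq_or_ne y 0 with rfl | hy
  · simp [majorant]
  have hd := decay_pos y
  have majorant_eq (k₁ k₂ : ℤ) : ENNReal.ofReal (majorant ![y, x₁ - k₁ * y, x₂ - k₂ * y]) =
      ENNReal.ofReal (y ^ 6 * decay y ^ 4) * (ENNReal.ofReal (decay (x₁ - k₁ * y)) *
        ENNReal.ofReal (decay (x₂ - k₂ * y))) := by
    rw [← ENNReal.ofReal_mul (decay_pos _).le, ← ENNReal.ofReal_mul (by positivity), ← mul_assoc]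
    rfl
  rw [ENNReal.tsum_prod (f := fun k₁ k₂ : ℤ =>
    ENNReal.ofReal (majorant ![y, x₁ - k₁ * y, x₂ - k₂ * y]))]
  simp_rw [majorant_eq, ENNReal.tsum_mul_left, ENNReal.tsum_mul_right]
  calc _ ≤ ENNReal.ofReal (y ^ 6 * decay y ^ 4) *
        ((ENNReal.ofReal (1 + (y ^ 2)⁻¹) * decaySum) *
          (ENNReal.ofReal (1 + (y ^ 2)⁻¹) * decaySum)) := by
        gcongr <;> exact tsum_decay_sub_mul_le _ hy
    _ = ENNReal.ofReal (y ^ 6 * decay y ^ 4) * (ENNReal.ofReal (1 + (y ^ 2)⁻¹) *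
        ENNReal.ofReal (1 + (y ^ 2)⁻¹)) * decaySum ^ 2 := by ring
    _ = _ := by
        rw [← ENNReal.ofReal_mul (by positivity), ← ENNReal.ofReal_mul (by positivity)]
        congr 2
        unfold decay
        field_simp
        ring

theorem tsum_majorant_le {ρ : ℝ} (hρ : ρ ^ 2 < 1) (b : ℕ → ℝ) (x₀ x₁ x₂ : ℝ) :
    ∑' p : ℕ × ℤ × ℤ, ENNReal.ofReal (majorant ![ρ ^ p.1 * x₀,
        b p.1 * x₁ - p.2.1 * (ρ ^ p.1 * x₀), b p.1 * x₂ - p.2.2 * (ρ ^ p.1 * x₀)]) ≤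
      ENNReal.ofReal (1 - ρ ^ 2)⁻¹ * decaySum ^ 2 := by
  rw [ENNReal.tsum_prod (f := fun (j : ℕ) (k : ℤ × ℤ) => ENNReal.ofReal (majorant ![ρ ^ j * x₀,
    b j * x₁ - k.1 * (ρ ^ j * x₀), b j * x₂ - k.2 * (ρ ^ j * x₀)]))]
  calc _ ≤ ∑' j : ℕ, ENNReal.ofReal ((ρ ^ j * x₀) ^ 2 * decay (ρ ^ j * x₀) ^ 2) *
        decaySum ^ 2 :=
        ENNReal.tsum_le_tsum fun j => tsum_majorant_shear_le (ρ ^ j * x₀) (b j * x₁) (b j * x₂)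
    _ ≤ _ := by
        rw [ENNReal.tsum_mul_right]
        gcongr
        exact tsum_sq_mul_decay_sq_le hρ x₀

/-! ### Tensor products -/

section TensorProd

variable {ι : Type*} [Fintype ι]

/-- The tensor product of univariate functions, as a function on Euclidean space. -/
def tensorProd (f : ι → ℝ → ℂ) (x : EuclideanSpace ℝ ι) : ℂ := ∏ i, f i (x i)

theorem integral_tensorProd (f : ι → ℝ → ℂ) : ∫ x, tensorProd f x = ∏ i, ∫ t, f i t := by
  rw [← (PiLp.volume_preserving_toLp ι).integral_comp
    (MeasurableEquiv.toLp 2 (ι → ℝ)).measurableEmbedding]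
  exact integral_fintype_prod_volume_eq_prod f

theorem integrable_tensorProd {f : ι → ℝ → ℂ} (hf : ∀ i, Integrable (f i)) :
    Integrable (tensorProd f) := by
  rw [← (PiLp.volume_preserving_toLp ι).integrable_comp_emb
    (MeasurableEquiv.toLp 2 (ι → ℝ)).measurableEmbedding]
  exact Integrable.fintype_prod hf

theorem measurable_tensorProd {f : ι → ℝ → ℂ} (hf : ∀ i, Measurable (f i)) :
    Measurable (tensorProd f) :=
  Finset.measurable_fun_prod _ fun i _ => (hf i).comp (by fun_prop)

theorem memLp_tensorProd {f : ι → ℝ → ℂ} (hf : ∀ i, Measurable (f i))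
    (hf₂ : ∀ i, MemLp (f i) 2) : MemLp (tensorProd f) 2 := by
  rw [memLp_two_iff_integrable_sq_norm (measurable_tensorProd hf).aestronglyMeasurable]
  have sq_integrable (i : ι) : Integrable fun t => ((‖f i t‖ ^ 2 : ℝ) : ℂ) :=
    ((hf₂ i).integrable_norm_pow two_ne_zero).ofReal
  refine (integrable_tensorProd sq_integrable).norm.congr (.of_forall fun x => ?_)
  simp [tensorProd, Finset.prod_pow]

theorem fourierInv_tensorProd (f : ι → ℝ → ℂ) :
    (𝓕⁻ (tensorProd f) : EuclideanSpace ℝ ι → ℂ) = tensorProd fun i => 𝓕⁻ (f i) := by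
  ext x
  simp only [tensorProd, Real.fourierInv_eq]
  rw [← integral_tensorProd]
  congr 1 with ξ
  have fourierChar_sum :
      (Real.fourierChar (∑ i, ⟪ξ i, x i⟫) : ℂ) = ∏ i, (Real.fourierChar ⟪ξ i, x i⟫ : ℂ) := by
    simp only [Real.fourierChar_apply, Finset.mul_sum, Complex.ofReal_sum, Finset.sum_mul,
      Complex.exp_sum]
  simp only [tensorProd, PiLp.inner_apply, fourierChar_sum, Circle.smul_def, smul_eq_mul,
    Finset.prod_mul_distrib]

theorem hasL2Fourier_tensorProd {φ F : ι → ℝ → ℂ} (h : ∀ i, HasL2Fourier (φ i) (F i))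
    (hF : ∀ i, Measurable (F i)) (hF₁ : ∀ i, Integrable (F i)) (hF₂ : ∀ i, MemLp (F i) 2) :
    HasL2Fourier (tensorProd φ) (tensorProd F) := by
  refine (HasL2Fourier.of_fourierInv (integrable_tensorProd hF₁)
    (memLp_tensorProd hF hF₂)).congr_left ?_
  have quasi (i : ι) :
      Measure.QuasiMeasurePreserving (fun x : EuclideanSpace ℝ ι => x i) volume volume :=
    (Measure.quasiMeasurePreserving_eval (fun _ : ι => (volume : Measure ℝ)) i).comp
      (PiLp.volume_preserving_ofLp ι).quasiMeasurePreserving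
  have ae_eq (i : ι) := (quasi i).ae ((h i).ae_eq_fourierInv (hF₁ i) (hF₂ i))
  filter_upwards [ae_all_iff.2 ae_eq] with x hx
  rw [fourierInv_tensorProd]
  exact Finset.prod_congr rfl fun i _ => hx i

theorem tensor3_eq_tensorProd (φ : ℝ → ℂ) : tensor3 φ = tensorProd fun _ => φ := by
  ext x
  simp [tensor3, tensorProd, Fin.prod_univ_three]

end TensorProd

theorem integrable_of_norm_le_decay {f : ℝ → ℂ} (hf : Measurable f) {C : ℝ}
    (h : ∀ x, ‖f x‖ ≤ C * decay x) : Integrable f :=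
  (integrable_decay.const_mul C).mono' hf.aestronglyMeasurable (.of_forall h)

theorem memLp_two_of_norm_le_decay {f : ℝ → ℂ} (hf : Measurable f) {C : ℝ}
    (h : ∀ x, ‖f x‖ ≤ C * decay x) : MemLp f 2 := by
  rw [memLp_two_iff_integrable_sq_norm hf.aestronglyMeasurable]
  refine (integrable_decay.const_mul (C ^ 2)).mono' (by fun_prop) (.of_forall fun x => ?_)
  have hd := decay_pos x
  calc ‖‖f x‖ ^ 2‖ = ‖f x‖ ^ 2 := Real.norm_of_nonneg (sq_nonneg _)
    _ ≤ (C * decay x) ^ 2 := by gcongr; exact h x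
    _ = C ^ 2 * (decay x * decay x) := by ring
    _ ≤ C ^ 2 * (decay x * 1) := by gcongr; exact decay_le_one x
    _ = C ^ 2 * decay x := by rw [mul_one]

/-! ### Dyadic products -/

theorem prod_range_succ_dyadic (q : ℝ → ℝ) (n : ℕ) (ξ : ℝ) :
    ∏ j ∈ Finset.range (n + 1), q (ξ / 2 ^ j) =
      (∏ j ∈ Finset.range n, q (ξ / 2 / 2 ^ j)) * q ξ := by
  rw [Finset.prod_range_succ', pow_zero, div_one]
  simp_rw [pow_succ', div_div]

theorem prod_dyadic_le_exp {q : ℝ → ℝ} {c : ℝ} (hc : 0 ≤ c) (hq₀ : ∀ x, 0 ≤ q x)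
    (hq : ∀ x, q x ≤ Real.exp (c * x ^ 2)) (n : ℕ) (ξ : ℝ) :
    ∏ j ∈ Finset.range n, q (ξ / 2 ^ j) ≤ Real.exp (2 * c * ξ ^ 2) := by
  induction n generalizing ξ with
  | zero =>
    rw [Finset.prod_range_zero]
    exact Real.one_le_exp (by positivity)
  | succ n ih =>
    calc ∏ j ∈ Finset.range (n + 1), q (ξ / 2 ^ j)
        ≤ Real.exp (2 * c * (ξ / 2) ^ 2) * Real.exp (c * ξ ^ 2) := by
          rw [prod_range_succ_dyadic]
          exact mul_le_mul (ih _) (hq ξ) (hq₀ ξ) (Real.exp_pos _).le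
      _ = Real.exp (2 * c * (ξ / 2) ^ 2 + c * ξ ^ 2) := (Real.exp_add _ _).symm
      _ ≤ Real.exp (2 * c * ξ ^ 2) :=
          Real.exp_le_exp.2 (by nlinarith [mul_nonneg hc (sq_nonneg ξ)])

theorem prod_dyadic_le_of_abs_le_two_pow {q : ℝ → ℝ} {c b : ℝ} (hc : 0 ≤ c) (hb : 1 ≤ b)
    (hq₀ : ∀ x, 0 ≤ q x) (hq : ∀ x, q x ≤ Real.exp (c * x ^ 2)) (hqb : ∀ x, q x ≤ b)
    (n J : ℕ) {ξ : ℝ} (hξ : |ξ| ≤ 2 ^ J) :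
    ∏ j ∈ Finset.range n, q (ξ / 2 ^ j) ≤ Real.exp (2 * c) * b ^ J := by
  have exp_ge : 1 ≤ Real.exp (2 * c) := Real.one_le_exp (by positivity)
  induction J generalizing n ξ with
  | zero =>
    have hξ' : ξ ^ 2 ≤ 1 := (sq_le_one_iff_abs_le_one ξ).2 (by simpa using hξ)
    rw [pow_zero, mul_one]
    exact (prod_dyadic_le_exp hc hq₀ hq n ξ).trans
      (Real.exp_le_exp.2 (mul_le_of_le_one_right (by positivity) hξ'))
  | succ J ih =>
    cases n with
    | zero =>
      rw [Finset.prod_range_zero]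
      exact one_le_mul_of_one_le_of_one_le exp_ge (one_le_pow₀ hb)
    | succ n =>
      have half : |ξ / 2| ≤ 2 ^ J := by
        rw [abs_div, abs_two, div_le_iff₀ two_pos, ← pow_succ]
        exact hξ
      rw [prod_range_succ_dyadic, pow_succ, ← mul_assoc]
      exact mul_le_mul (ih n half) (hqb ξ) (hq₀ ξ) (by positivity)

/-- Only about `log₂ |ξ|` of the factors are evaluated outside the unit ball. -/
theorem prod_dyadic_le_pow {q : ℝ → ℝ} {c : ℝ} {r : ℕ} (hc : 0 ≤ c) (hq₀ : ∀ x, 0 ≤ q x)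
    (hq : ∀ x, q x ≤ Real.exp (c * x ^ 2)) (hqr : ∀ x, q x ≤ 2 ^ r) (n : ℕ) {ξ : ℝ}
    (hξ : 1 ≤ |ξ|) :
    ∏ j ∈ Finset.range n, q (ξ / 2 ^ j) ≤ Real.exp (2 * c) * 2 ^ r * |ξ| ^ r := by
  obtain ⟨J, hJ, hJ'⟩ := exists_nat_pow_near hξ one_lt_two
  calc ∏ j ∈ Finset.range n, q (ξ / 2 ^ j) ≤ Real.exp (2 * c) * (2 ^ r) ^ (J + 1) :=
        prod_dyadic_le_of_abs_le_two_pow hc (one_le_pow₀ one_le_two) hq₀ hq hqr n _ hJ'.le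
    _ = Real.exp (2 * c) * 2 ^ r * (2 ^ J) ^ r := by ring
    _ ≤ Real.exp (2 * c) * 2 ^ r * |ξ| ^ r := by gcongr

theorem prod_cos_mul_sin (x : ℝ) (n : ℕ) :
    (∏ j ∈ Finset.range n, Real.cos (x / 2 ^ j)) * (2 ^ n * Real.sin (2 * x / 2 ^ n)) =
      Real.sin (2 * x) := by
  induction n with
  | zero => simp
  | succ n ih =>
    have double : 2 * x / 2 ^ n = 2 * (x / 2 ^ n) := by ring
    have halve : 2 * x / 2 ^ (n + 1) = x / 2 ^ n := by rw [pow_succ]; field_simp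
    rw [Finset.prod_range_succ, ← ih, double, halve, Real.sin_two_mul]
    ring

theorem abs_prod_cos_le_one (x : ℝ) (n : ℕ) :
    |∏ j ∈ Finset.range n, Real.cos (x / 2 ^ j)| ≤ 1 := by
  rw [Finset.abs_prod]
  exact Finset.prod_le_one (fun _ _ => abs_nonneg _) fun _ _ => Real.abs_cos_le_one _

theorem two_div_pi_le_abs_prod_cos {x : ℝ} (hx : |x| ≤ Real.pi / 4) (n : ℕ) :
    2 / Real.pi ≤ |∏ j ∈ Finset.range n, Real.cos (x / 2 ^ j)| := by
  rcases eq_or_ne x 0 with rfl | hx₀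
  · simp only [zero_div, Real.cos_zero, Finset.prod_const_one, abs_one]
    rw [div_le_one Real.pi_pos]
    linarith [Real.pi_gt_three]
  have sin_ge : 2 / Real.pi * |2 * x| ≤ |Real.sin (2 * x)| :=
    Real.mul_abs_le_abs_sin (by rw [abs_mul, abs_two]; linarith)
  have sin_le : |2 ^ n * Real.sin (2 * x / 2 ^ n)| ≤ |2 * x| := by
    rw [abs_mul, abs_of_pos (by positivity : (0 : ℝ) < 2 ^ n), ← le_div_iff₀' (by positivity)]
    refine Real.abs_sin_le_abs.trans_eq ?_
    rw [abs_div, abs_of_pos (by positivity : (0 : ℝ) < 2 ^ n)]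
  rw [← prod_cos_mul_sin x n, abs_mul (∏ _ ∈ _, _)] at sin_ge
  exact le_of_mul_le_mul_right
    (sin_ge.trans (mul_le_mul_of_nonneg_left sin_le (abs_nonneg _))) (by positivity)

theorem tendsto_div_two_pow (x : ℝ) : Tendsto (fun n : ℕ => x / (2 : ℝ) ^ n) atTop (𝓝 0) :=
  tendsto_const_nhds.div_atTop (tendsto_pow_atTop_atTop_of_one_lt one_lt_two)

theorem tendsto_two_pow_mul_sin (x : ℝ) :
    Tendsto (fun n : ℕ => (2 : ℝ) ^ n * Real.sin (x / 2 ^ n)) atTop (𝓝 x) := by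
  rcases eq_or_ne x 0 with rfl | hx
  · simp
  have tendsto_sinc := ((Real.continuous_sinc.tendsto 0).comp (tendsto_div_two_pow x)).const_mul x
  rw [Real.sinc_zero, mul_one] at tendsto_sinc
  refine tendsto_sinc.congr fun n => ?_
  have hxn : x / (2 : ℝ) ^ n ≠ 0 := by positivity
  rw [Function.comp_apply, Real.sinc_of_ne_zero hxn]
  field_simp

/-! ### The low pass filter and the scaling function -/

/-- The polynomial `∑ n < L, binom (K - 1 + n) n yⁿ` with
`lowPassSq K L ξ = cos²ᴷ(πξ) · filterPoly K L (sin²(πξ))`. -/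
def filterPoly (K L : ℕ) (y : ℝ) : ℝ := ∑ n ∈ Finset.range L, ((K - 1 + n).choose n : ℝ) * y ^ n

theorem lowPassSq_eq (K L : ℕ) (ξ : ℝ) : lowPassSq K L ξ =
    Real.cos (Real.pi * ξ) ^ (2 * K) * filterPoly K L (Real.sin (Real.pi * ξ) ^ 2) := by
  simp only [lowPassSq, filterPoly, pow_mul]

theorem filterPoly_nonneg (K L : ℕ) {y : ℝ} (hy : 0 ≤ y) : 0 ≤ filterPoly K L y :=
  Finset.sum_nonneg fun n _ => by positivity

theorem one_le_filterPoly (K : ℕ) {L : ℕ} (hL : 1 ≤ L) {y : ℝ} (hy : 0 ≤ y) :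
    1 ≤ filterPoly K L y := by
  have := Finset.single_le_sum (f := fun n => ((K - 1 + n).choose n : ℝ) * y ^ n)
    (s := Finset.range L) (fun n _ => by positivity) (Finset.mem_range.2 hL)
  simpa [filterPoly] using this

theorem sum_choose_le_two_pow (K L : ℕ) :
    ∑ n ∈ Finset.range L, (K - 1 + n).choose n ≤ 2 ^ (K - 1 + L) := by
  induction L with
  | zero => simp
  | succ L ih =>
    rw [Finset.sum_range_succ, ← add_assoc, pow_succ, mul_two]
    exact Nat.add_le_add ih (Nat.choose_le_two_pow _ _)

theorem filterPoly_le_two_pow (K L : ℕ) {y : ℝ} (hy : 0 ≤ y) (hy₁ : y ≤ 1) :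
    filterPoly K L y ≤ 2 ^ (K - 1 + L) := by
  calc filterPoly K L y ≤ ∑ n ∈ Finset.range L, ((K - 1 + n).choose n : ℝ) :=
        Finset.sum_le_sum fun n _ =>
          mul_le_of_le_one_right (Nat.cast_nonneg _) (pow_le_one₀ hy hy₁)
    _ ≤ 2 ^ (K - 1 + L) := by exact_mod_cast sum_choose_le_two_pow K L

theorem filterPoly_le_one_add (K L : ℕ) {y : ℝ} (hy : 0 ≤ y) (hy₁ : y ≤ 1) :
    filterPoly K L y ≤ 1 + 2 ^ (K - 1 + L) * y := by
  have term_le (n : ℕ) : ((K - 1 + n).choose n : ℝ) * y ^ n ≤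
      (if n = 0 then 1 else 0) + (K - 1 + n).choose n * y := by
    rcases Nat.eq_zero_or_pos n with rfl | hn
    · simpa using hy
    · rw [if_neg hn.ne', zero_add]
      gcongr
      exact pow_le_of_le_one hy hy₁ hn.ne'
  calc filterPoly K L y
      ≤ ∑ n ∈ Finset.range L, ((if n = 0 then (1 : ℝ) else 0) + (K - 1 + n).choose n * y) :=
        Finset.sum_le_sum fun n _ => term_le n
    _ = (∑ n ∈ Finset.range L, if n = 0 then (1 : ℝ) else 0) +
          (∑ n ∈ Finset.range L, ((K - 1 + n).choose n : ℝ)) * y := by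
        rw [Finset.sum_add_distrib, Finset.sum_mul]
    _ ≤ 1 + 2 ^ (K - 1 + L) * y := by
        gcongr
        · rw [Finset.sum_ite_eq']
          split_ifs <;> norm_num
        · exact_mod_cast sum_choose_le_two_pow K L

theorem filterPoly_sin_sq_le_exp (K L : ℕ) (x : ℝ) :
    filterPoly K L (Real.sin (Real.pi * x) ^ 2) ≤
      Real.exp (2 ^ (K - 1 + L) * Real.pi ^ 2 * x ^ 2) := by
  have sin_sq_le : Real.sin (Real.pi * x) ^ 2 ≤ (Real.pi * x) ^ 2 :=
    sq_le_sq.2 Real.abs_sin_le_abs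
  calc filterPoly K L (Real.sin (Real.pi * x) ^ 2)
      ≤ 1 + 2 ^ (K - 1 + L) * Real.sin (Real.pi * x) ^ 2 :=
        filterPoly_le_one_add K L (sq_nonneg _) (Real.sin_sq_le_one _)
    _ ≤ 1 + 2 ^ (K - 1 + L) * (Real.pi * x) ^ 2 := by gcongr
    _ = 2 ^ (K - 1 + L) * Real.pi ^ 2 * x ^ 2 + 1 := by ring
    _ ≤ _ := Real.add_one_le_exp _

section ScalingHat

variable {K L : ℕ} {m₀ m₁ : ℝ → ℂ}

theorem tendsto_scalingHat (hm₀ : IsLowPassFilter m₀) (ξ : ℝ) :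
    Tendsto (fun n : ℕ => ∏ j ∈ Finset.range n, m₀ (ξ / 2 ^ j)) atTop (𝓝 (scalingHat m₀ ξ)) := by
  have sub_one_isBigO : (fun n : ℕ => m₀ (ξ / 2 ^ n) - 1) =O[atTop] fun n : ℕ => ξ / (2 : ℝ) ^ n :=
    hm₀.isBigO.comp_tendsto (tendsto_div_two_pow ξ)
  have summable_geometric : Summable fun n : ℕ => ξ / (2 : ℝ) ^ n := by
    simpa [div_eq_mul_inv] using summable_geometric_two.mul_left ξ
  have multipliable : Multipliable fun n : ℕ => 1 + (m₀ (ξ / 2 ^ n) - 1) :=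
    multipliable_one_add_of_summable
      (summable_of_isBigO_nat summable_geometric sub_one_isBigO.norm_left)
  simp only [add_sub_cancel] at multipliable
  exact multipliable.hasProd.tendsto_prod_nat

theorem measurable_scalingHat (hm₀ : IsLowPassFilter m₀) : Measurable (scalingHat m₀) := by
  have := hm₀.measurable
  exact measurable_of_tendsto_metrizable
    (f := fun n ξ => ∏ j ∈ Finset.range n, m₀ (ξ / 2 ^ j)) (fun n => by fun_prop)
    (tendsto_pi_nhds.2 (tendsto_scalingHat hm₀))

theorem norm_prod_lowPass_sq (hq : ∀ ξ : ℝ, ‖m₀ ξ‖ ^ 2 = lowPassSq K L ξ) (n : ℕ) (ξ : ℝ) :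
    ‖∏ j ∈ Finset.range n, m₀ (ξ / 2 ^ j)‖ ^ 2 =
      (|∏ j ∈ Finset.range n, Real.cos (Real.pi * ξ / 2 ^ j)| ^ 2) ^ K *
        ∏ j ∈ Finset.range n, filterPoly K L (Real.sin (Real.pi * (ξ / 2 ^ j)) ^ 2) := by
  rw [norm_prod, sq_abs, ← pow_mul, ← Finset.prod_pow, ← Finset.prod_pow,
    ← Finset.prod_mul_distrib]
  refine Finset.prod_congr rfl fun j _ => ?_
  rw [hq, lowPassSq_eq, mul_div_assoc]

theorem norm_scalingHat_sq_le_exp (hm₀ : IsLowPassFilter m₀)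
    (hq : ∀ ξ : ℝ, ‖m₀ ξ‖ ^ 2 = lowPassSq K L ξ) (ξ : ℝ) :
    ‖scalingHat m₀ ξ‖ ^ 2 ≤ Real.exp (2 * (2 ^ (K - 1 + L) * Real.pi ^ 2) * ξ ^ 2) := by
  refine le_of_tendsto ((tendsto_scalingHat hm₀ ξ).norm.pow 2) (.of_forall fun n => ?_)
  rw [norm_prod_lowPass_sq hq]
  have cos_le : (|∏ j ∈ Finset.range n, Real.cos (Real.pi * ξ / 2 ^ j)| ^ 2) ^ K ≤ 1 :=
    pow_le_one₀ (by positivity) (pow_le_one₀ (abs_nonneg _) (abs_prod_cos_le_one _ n))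
  exact (mul_le_of_le_one_left
    (Finset.prod_nonneg fun j _ => filterPoly_nonneg K L (sq_nonneg _)) cos_le).trans
    (prod_dyadic_le_exp (q := fun x => filterPoly K L (Real.sin (Real.pi * x) ^ 2)) (by positivity)
      (fun x => filterPoly_nonneg K L (sq_nonneg _)) (filterPoly_sin_sq_le_exp K L) n ξ)

/-- The cosine factors form the product `∏ cos²ᴷ(πξ/2ʲ) = sinc²ᴷ(2πξ)`, which beats the growth of
the polynomial factors. -/
theorem norm_scalingHat_sq_mul_le (hm₀ : IsLowPassFilter m₀)
    (hq : ∀ ξ : ℝ, ‖m₀ ξ‖ ^ 2 = lowPassSq K L ξ) {ξ : ℝ} (hξ : 1 ≤ |ξ|) :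
    ‖scalingHat m₀ ξ‖ ^ 2 * |ξ| ^ (2 * K) ≤
      Real.exp (2 * (2 ^ (K - 1 + L) * Real.pi ^ 2)) * 2 ^ (K - 1 + L) * |ξ| ^ (K - 1 + L) := by
  have lim := ((tendsto_scalingHat hm₀ ξ).norm.pow 2).mul
    ((tendsto_two_pow_mul_sin (2 * (Real.pi * ξ))).pow (2 * K))
  have le_two_pi : |ξ| ^ (2 * K) ≤ (2 * (Real.pi * ξ)) ^ (2 * K) := by
    rw [← (even_two_mul K).pow_abs (2 * (Real.pi * ξ)), ← mul_assoc, abs_mul]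
    gcongr
    refine le_mul_of_one_le_left (abs_nonneg _) (le_abs.2 (Or.inl ?_))
    linarith [Real.pi_gt_three]
  refine (mul_le_mul_of_nonneg_left le_two_pi (sq_nonneg _)).trans
    (le_of_tendsto lim (.of_forall fun n => ?_))
  have sin_le : Real.sin (2 * (Real.pi * ξ)) ^ (2 * K) ≤ 1 := by
    rw [pow_mul]
    exact pow_le_one₀ (sq_nonneg _) (Real.sin_sq_le_one _)
  rw [norm_prod_lowPass_sq hq, sq_abs, ← pow_mul, mul_right_comm, ← mul_pow, prod_cos_mul_sin]
  exact (mul_le_of_le_one_left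
    (Finset.prod_nonneg fun j _ => filterPoly_nonneg K L (sq_nonneg _)) sin_le).trans
    (prod_dyadic_le_pow (q := fun x => filterPoly K L (Real.sin (Real.pi * x) ^ 2)) (by positivity)
      (fun x => filterPoly_nonneg K L (sq_nonneg _)) (filterPoly_sin_sq_le_exp K L)
      (fun x => filterPoly_le_two_pow K L (sq_nonneg _) (Real.sin_sq_le_one _)) n hξ)

theorem exists_norm_scalingHat_le (hm₀ : IsLowPassFilter m₀)
    (hq : ∀ ξ : ℝ, ‖m₀ ξ‖ ^ 2 = lowPassSq K L ξ) (hKL : L + 3 ≤ K) :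
    ∃ C : ℝ, 0 < C ∧ ∀ ξ, ‖scalingHat m₀ ξ‖ ≤ C * decay ξ := by
  set M : ℝ := Real.exp (2 * (2 ^ (K - 1 + L) * Real.pi ^ 2)) * 2 ^ (K - 1 + L)
  have hM₀ : 0 < M := by positivity
  have sq_le (ξ : ℝ) : ‖scalingHat m₀ ξ‖ ^ 2 * (1 + ξ ^ 2) ^ 2 ≤ 2 ^ 2 * M := by
    rcases le_total |ξ| 1 with h | h
    · have hξ : ξ ^ 2 ≤ 1 := (sq_le_one_iff_abs_le_one ξ).2 h
      have norm_sq_le : ‖scalingHat m₀ ξ‖ ^ 2 ≤ M :=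
        ((norm_scalingHat_sq_le_exp hm₀ hq ξ).trans (Real.exp_le_exp.2
          (mul_le_of_le_one_right (by positivity) hξ))).trans
          (le_mul_of_one_le_right (Real.exp_pos _).le (one_le_pow₀ one_le_two))
      rw [mul_comm (2 ^ 2)]
      gcongr
      linarith
    · have hξ : 1 ≤ ξ ^ 2 := one_le_sq_iff_one_le_abs _ |>.2 h
      have norm_sq_mul_le : ‖scalingHat m₀ ξ‖ ^ 2 * (ξ ^ 2) ^ 2 ≤ M := by
        refine le_of_mul_le_mul_right ?_ (pow_pos (one_pos.trans_le h) (K - 1 + L))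
        refine le_trans ?_ (norm_scalingHat_sq_mul_le hm₀ hq h)
        rw [← sq_abs ξ, ← pow_mul, mul_assoc, ← pow_add]
        gcongr
        omega
      calc ‖scalingHat m₀ ξ‖ ^ 2 * (1 + ξ ^ 2) ^ 2
          ≤ ‖scalingHat m₀ ξ‖ ^ 2 * (ξ ^ 2 + ξ ^ 2) ^ 2 := by gcongr
        _ = 2 ^ 2 * (‖scalingHat m₀ ξ‖ ^ 2 * (ξ ^ 2) ^ 2) := by ring
        _ ≤ 2 ^ 2 * M := by gcongr
  refine ⟨2 * √M, by positivity, fun ξ => le_of_sq_le_sq ?_ (by unfold decay; positivity)⟩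
  rw [decay, mul_pow, mul_pow, Real.sq_sqrt hM₀.le, inv_pow, ← div_eq_mul_inv,
    le_div_iff₀ (by positivity)]
  exact sq_le ξ

theorem le_norm_scalingHat_sq (hm₀ : IsLowPassFilter m₀)
    (hq : ∀ ξ : ℝ, ‖m₀ ξ‖ ^ 2 = lowPassSq K L ξ) (hL : 1 ≤ L) {ξ : ℝ} (hξ : |ξ| ≤ 1 / 4) :
    ((2 / Real.pi) ^ 2) ^ K ≤ ‖scalingHat m₀ ξ‖ ^ 2 := by
  have hπ := Real.pi_pos
  refine ge_of_tendsto ((tendsto_scalingHat hm₀ ξ).norm.pow 2) (.of_forall fun n => ?_)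
  rw [norm_prod_lowPass_sq hq]
  have poly_ge : 1 ≤ ∏ j ∈ Finset.range n, filterPoly K L (Real.sin (Real.pi * (ξ / 2 ^ j)) ^ 2) :=
    Finset.one_le_prod fun j _ => one_le_filterPoly K hL (sq_nonneg _)
  refine le_trans ?_ (le_mul_of_one_le_right (by positivity) poly_ge)
  gcongr
  refine two_div_pi_le_abs_prod_cos ?_ n
  rw [abs_mul, abs_of_pos hπ]
  nlinarith

theorem one_le_of_lowPassSq_eq (hm₀ : IsLowPassFilter m₀)
    (hq : ∀ ξ : ℝ, ‖m₀ ξ‖ ^ 2 = lowPassSq K L ξ) : 1 ≤ L := by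
  rw [Nat.one_le_iff_ne_zero]
  rintro rfl
  simpa [lowPassSq, hm₀.map_zero] using hq 0

/-! ### The high pass filter and the shearlet generator -/

theorem norm_highPass_sq (hq : ∀ ξ : ℝ, ‖m₀ ξ‖ ^ 2 = lowPassSq K L ξ)
    (hm₁ : ∀ ξ : ℝ, ‖m₁ ξ‖ ^ 2 = ‖m₀ (ξ + 1 / 2)‖ ^ 2) (ξ : ℝ) : ‖m₁ ξ‖ ^ 2 =
      (Real.sin (Real.pi * ξ) ^ 2) ^ K * filterPoly K L (Real.cos (Real.pi * ξ) ^ 2) := by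
  rw [hm₁, hq, lowPassSq_eq, show Real.pi * (ξ + 1 / 2) = Real.pi * ξ + Real.pi / 2 by ring,
    Real.cos_add_pi_div_two, Real.sin_add_pi_div_two, pow_mul, neg_sq]

theorem sin_sq_le_sq_mul_decay (a y : ℝ) :
    Real.sin (a * y) ^ 2 ≤ (a ^ 2 + 1) * (y ^ 2 * decay y) := by
  have sin_sq_le : Real.sin (a * y) ^ 2 ≤ (a * y) ^ 2 := sq_le_sq.2 Real.abs_sin_le_abs
  have sin_sq_le_one := Real.sin_sq_le_one (a * y)
  unfold decay
  rw [← div_eq_mul_inv, ← mul_div_assoc, le_div_iff₀ (by positivity)]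
  nlinarith [mul_le_mul_of_nonneg_right sin_sq_le_one (sq_nonneg y)]

theorem exists_norm_highPass_sq_le (hq : ∀ ξ : ℝ, ‖m₀ ξ‖ ^ 2 = lowPassSq K L ξ)
    (hm₁ : ∀ ξ : ℝ, ‖m₁ ξ‖ ^ 2 = ‖m₀ (ξ + 1 / 2)‖ ^ 2) {r : ℕ} (hr : r ≤ K) :
    ∃ C : ℝ, 0 < C ∧ ∀ y, ‖m₁ (4 * y)‖ ^ 2 ≤ C * (y ^ 2 * decay y) ^ r := by
  refine ⟨((Real.pi * 4) ^ 2 + 1) ^ r * 2 ^ (K - 1 + L), by positivity, fun y => ?_⟩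
  rw [norm_highPass_sq hq hm₁, ← mul_assoc]
  calc (Real.sin (Real.pi * 4 * y) ^ 2) ^ K * filterPoly K L (Real.cos (Real.pi * 4 * y) ^ 2)
      ≤ (Real.sin (Real.pi * 4 * y) ^ 2) ^ r * 2 ^ (K - 1 + L) :=
        mul_le_mul (pow_le_pow_of_le_one (sq_nonneg _) (Real.sin_sq_le_one _) hr)
          (filterPoly_le_two_pow K L (sq_nonneg _) (Real.cos_sq_le_one _))
          (filterPoly_nonneg K L (sq_nonneg _)) (by positivity)
    _ ≤ (((Real.pi * 4) ^ 2 + 1) * (y ^ 2 * decay y)) ^ r * 2 ^ (K - 1 + L) := by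
        gcongr
        exact sin_sq_le_sq_mul_decay _ y
    _ = _ := by rw [mul_pow]; ring

theorem two_mul_min_le_sin {t : ℝ} (ht₀ : 0 ≤ t) (ht₁ : t ≤ 1) :
    2 * min t (1 - t) ≤ Real.sin (Real.pi * t) := by
  have hπ := Real.pi_pos
  rcases le_total t (1 / 2) with h | h
  · have := Real.mul_le_sin (x := Real.pi * t) (by positivity) (by nlinarith)
    rw [← mul_assoc, div_mul_cancel₀ _ hπ.ne'] at this
    exact (mul_le_mul_of_nonneg_left (min_le_left _ _) zero_le_two).trans this
  · have := Real.mul_le_sin (x := Real.pi * (1 - t))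
      (mul_nonneg hπ.le (by linarith)) (by nlinarith)
    rw [← mul_assoc, div_mul_cancel₀ _ hπ.ne', mul_one_sub Real.pi, Real.sin_pi_sub] at this
    exact (mul_le_mul_of_nonneg_left (min_le_right _ _) zero_le_two).trans this

theorem le_norm_highPass_sq (hq : ∀ ξ : ℝ, ‖m₀ ξ‖ ^ 2 = lowPassSq K L ξ)
    (hm₁ : ∀ ξ : ℝ, ‖m₁ ξ‖ ^ 2 = ‖m₀ (ξ + 1 / 2)‖ ^ 2) (hL : 1 ≤ L) {ε y : ℝ} (hε : 0 ≤ ε)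
    (hεy : ε ≤ |y|) (hy : |y| ≤ 1 / 5) :
    ((2 * min (4 * ε) (1 / 5)) ^ 2) ^ K ≤ ‖m₁ (4 * y)‖ ^ 2 := by
  rw [norm_highPass_sq hq hm₁]
  refine le_trans ?_
    (le_mul_of_one_le_right (by positivity) (one_le_filterPoly K hL (sq_nonneg _)))
  have sin_abs : Real.sin (Real.pi * (4 * y)) ^ 2 = Real.sin (Real.pi * (4 * |y|)) ^ 2 := by
    rcases abs_choice y with h | h <;> simp [h]
  rw [sin_abs]
  gcongr
  calc 2 * min (4 * ε) (1 / 5) ≤ 2 * min (4 * |y|) (1 - 4 * |y|) := by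
        gcongr
        linarith
    _ ≤ _ := two_mul_min_le_sin (by positivity) (by linarith)

end ScalingHat

section ShearletHat

variable {K L : ℕ} {m₀ m₁ : ℝ → ℂ}

/-- The univariate tensor factors of the Fourier transform of the shearlet generator. -/
def shearletFactor (m₀ m₁ : ℝ → ℂ) : Fin 3 → ℝ → ℂ :=
  ![fun y => m₁ (4 * y) * scalingHat m₀ y, fun y => scalingHat m₀ (2 * y),
    fun y => scalingHat m₀ (2 * y)]

theorem shearletHat_eq_tensorProd (m₀ m₁ : ℝ → ℂ) :
    shearletHat m₀ m₁ = tensorProd (shearletFactor m₀ m₁) := by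
  ext η
  simp [shearletHat, shearletFactor, tensorProd, Fin.prod_univ_three]

theorem measurable_shearletFactor (hm₀ : IsLowPassFilter m₀) (hm₁ : IsFilter m₁) (i : Fin 3) :
    Measurable (shearletFactor m₀ m₁ i) := by
  have := measurable_scalingHat hm₀
  have := hm₁.measurable
  fin_cases i <;> simp only [shearletFactor] <;> dsimp <;> fun_prop

theorem exists_norm_shearletFactor_zero_sq_le (hm₀ : IsLowPassFilter m₀)
    (hq : ∀ ξ : ℝ, ‖m₀ ξ‖ ^ 2 = lowPassSq K L ξ)
    (hm₁ : ∀ ξ : ℝ, ‖m₁ ξ‖ ^ 2 = ‖m₀ (ξ + 1 / 2)‖ ^ 2) (hKL : L + 3 ≤ K) :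
    ∃ C : ℝ, 0 < C ∧ ∀ y, ‖shearletFactor m₀ m₁ 0 y‖ ^ 2 ≤ C * (y ^ 6 * decay y ^ 5) := by
  obtain ⟨C₀, hC₀, norm_scalingHat_le⟩ := exists_norm_scalingHat_le hm₀ hq hKL
  obtain ⟨C₁, hC₁, norm_highPass_le⟩ := exists_norm_highPass_sq_le hq hm₁ (r := 3) (by omega)
  refine ⟨C₁ * C₀ ^ 2, by positivity, fun y => ?_⟩
  have := decay_pos y
  calc ‖m₁ (4 * y) * scalingHat m₀ y‖ ^ 2 = ‖m₁ (4 * y)‖ ^ 2 * ‖scalingHat m₀ y‖ ^ 2 := by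
        rw [norm_mul, mul_pow]
    _ ≤ C₁ * (y ^ 2 * decay y) ^ 3 * (C₀ * decay y) ^ 2 := by
        gcongr
        exacts [norm_highPass_le y, norm_scalingHat_le y]
    _ = _ := by ring

theorem pow_six_mul_decay_pow_five_le (y : ℝ) : y ^ 6 * decay y ^ 5 ≤ decay y ^ 2 := by
  have := decay_pos y
  rw [show y ^ 6 * decay y ^ 5 = (y ^ 2 * decay y) ^ 3 * decay y ^ 2 by ring]
  exact mul_le_of_le_one_left (sq_nonneg _) (pow_le_one₀ (by positivity) (sq_mul_decay_le_one y))

theorem exists_norm_shearletFactor_sq_le (hm₀ : IsLowPassFilter m₀)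
    (hq : ∀ ξ : ℝ, ‖m₀ ξ‖ ^ 2 = lowPassSq K L ξ)
    (hm₁ : ∀ ξ : ℝ, ‖m₁ ξ‖ ^ 2 = ‖m₀ (ξ + 1 / 2)‖ ^ 2) (hKL : L + 3 ≤ K) :
    ∃ C : ℝ, 0 < C ∧
      (∀ y, ‖shearletFactor m₀ m₁ 0 y‖ ^ 2 ≤ C * (y ^ 6 * decay y ^ 5)) ∧
      ∀ i, ∀ y, ‖shearletFactor m₀ m₁ i y‖ ^ 2 ≤ C * decay y ^ 2 := by
  obtain ⟨C₀, hC₀, norm_scalingHat_le⟩ := exists_norm_scalingHat_le hm₀ hq hKL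
  obtain ⟨C₁, hC₁, zero_le⟩ := exists_norm_shearletFactor_zero_sq_le hm₀ hq hm₁ hKL
  have zero_le_max (y : ℝ) :
      ‖shearletFactor m₀ m₁ 0 y‖ ^ 2 ≤ max C₁ (C₀ ^ 2) * (y ^ 6 * decay y ^ 5) := by
    have := decay_pos y
    exact (zero_le y).trans (mul_le_mul_of_nonneg_right (le_max_left _ _) (by positivity))
  have dilated_le (y : ℝ) : ‖scalingHat m₀ (2 * y)‖ ^ 2 ≤ max C₁ (C₀ ^ 2) * decay y ^ 2 := by
    refine le_trans ?_ (mul_le_mul_of_nonneg_right (le_max_right _ _) (sq_nonneg _))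
    rw [← mul_pow]
    gcongr
    refine (norm_scalingHat_le _).trans (mul_le_mul_of_nonneg_left ?_ hC₀.le)
    refine decay_le_decay_of_abs_le ?_
    rw [abs_mul, abs_two]
    linarith [abs_nonneg y]
  refine ⟨max C₁ (C₀ ^ 2), by positivity, zero_le_max, fun i y => ?_⟩
  fin_cases i
  · exact (zero_le_max y).trans
      (mul_le_mul_of_nonneg_left (pow_six_mul_decay_pow_five_le y) (by positivity))
  · exact dilated_le y
  · exact dilated_le y

theorem exists_norm_shearletFactor_le (hm₀ : IsLowPassFilter m₀)
    (hq : ∀ ξ : ℝ, ‖m₀ ξ‖ ^ 2 = lowPassSq K L ξ)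
    (hm₁ : ∀ ξ : ℝ, ‖m₁ ξ‖ ^ 2 = ‖m₀ (ξ + 1 / 2)‖ ^ 2) (hKL : L + 3 ≤ K) :
    ∃ C : ℝ, ∀ i, ∀ y, ‖shearletFactor m₀ m₁ i y‖ ≤ C * decay y := by
  obtain ⟨C, hC, -, norm_sq_le⟩ := exists_norm_shearletFactor_sq_le hm₀ hq hm₁ hKL
  refine ⟨√C, fun i y => le_of_sq_le_sq ?_ (mul_nonneg (Real.sqrt_nonneg _) (decay_pos y).le)⟩
  rw [mul_pow, Real.sq_sqrt hC.le]
  exact norm_sq_le i y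

theorem integrable_shearletHat (hm₀ : IsLowPassFilter m₀) (hm₁ : IsFilter m₁)
    (hq : ∀ ξ : ℝ, ‖m₀ ξ‖ ^ 2 = lowPassSq K L ξ)
    (hm₁q : ∀ ξ : ℝ, ‖m₁ ξ‖ ^ 2 = ‖m₀ (ξ + 1 / 2)‖ ^ 2) (hKL : L + 3 ≤ K) :
    Integrable (shearletHat m₀ m₁) := by
  obtain ⟨C, norm_le⟩ := exists_norm_shearletFactor_le hm₀ hq hm₁q hKL
  rw [shearletHat_eq_tensorProd]
  exact integrable_tensorProd fun i =>
    integrable_of_norm_le_decay (measurable_shearletFactor hm₀ hm₁ i) (norm_le i)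

theorem memLp_shearletHat (hm₀ : IsLowPassFilter m₀) (hm₁ : IsFilter m₁)
    (hq : ∀ ξ : ℝ, ‖m₀ ξ‖ ^ 2 = lowPassSq K L ξ)
    (hm₁q : ∀ ξ : ℝ, ‖m₁ ξ‖ ^ 2 = ‖m₀ (ξ + 1 / 2)‖ ^ 2) (hKL : L + 3 ≤ K) :
    MemLp (shearletHat m₀ m₁) 2 := by
  obtain ⟨C, norm_le⟩ := exists_norm_shearletFactor_le hm₀ hq hm₁q hKL
  rw [shearletHat_eq_tensorProd]
  exact memLp_tensorProd (measurable_shearletFactor hm₀ hm₁) fun i =>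
    memLp_two_of_norm_le_decay (measurable_shearletFactor hm₀ hm₁ i) (norm_le i)

theorem exists_norm_shearletHat_sq_le (hm₀ : IsLowPassFilter m₀)
    (hq : ∀ ξ : ℝ, ‖m₀ ξ‖ ^ 2 = lowPassSq K L ξ)
    (hm₁ : ∀ ξ : ℝ, ‖m₁ ξ‖ ^ 2 = ‖m₀ (ξ + 1 / 2)‖ ^ 2) (hKL : L + 3 ≤ K) :
    ∃ C : ℝ, 0 < C ∧ ∀ η, ‖shearletHat m₀ m₁ η‖ ^ 2 ≤
      C * majorant η.ofLp * ∏ i, decay (η i) := by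
  obtain ⟨C, hC, first_le, all_le⟩ := exists_norm_shearletFactor_sq_le hm₀ hq hm₁ hKL
  refine ⟨C ^ 3, by positivity, fun η => ?_⟩
  rw [shearletHat_eq_tensorProd, tensorProd, norm_prod, ← Finset.prod_pow, Fin.prod_univ_three,
    Fin.prod_univ_three]
  have := decay_pos (η 0)
  calc _ ≤ C * (η 0 ^ 6 * decay (η 0) ^ 5) * (C * decay (η 1) ^ 2) * (C * decay (η 2) ^ 2) := by
        gcongr
        exacts [first_le _, all_le 1 _, all_le 2 _]
    _ = _ := by unfold majorant; ring

theorem exists_le_norm_shearletHat_sq (hm₀ : IsLowPassFilter m₀)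
    (hq : ∀ ξ : ℝ, ‖m₀ ξ‖ ^ 2 = lowPassSq K L ξ)
    (hm₁ : ∀ ξ : ℝ, ‖m₁ ξ‖ ^ 2 = ‖m₀ (ξ + 1 / 2)‖ ^ 2) (hL : 1 ≤ L) {ε : ℝ} (hε : 0 < ε) :
    ∃ A : ℝ, 0 < A ∧ ∀ η : R3, ε ≤ |η 0| → |η 0| ≤ 1 / 5 → |η 1| ≤ 1 / 10 → |η 2| ≤ 1 / 10 →
      A ≤ ‖shearletHat m₀ m₁ η‖ ^ 2 := by
  refine ⟨((2 * min (4 * ε) (1 / 5)) ^ 2) ^ K * ((2 / Real.pi) ^ 2) ^ K * ((2 / Real.pi) ^ 2) ^ K *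
    ((2 / Real.pi) ^ 2) ^ K, by positivity, fun η h₀ h₀' h₁ h₂ => ?_⟩
  have scaling_ge {y : ℝ} (hy : |y| ≤ 1 / 4) := le_norm_scalingHat_sq hm₀ hq hL hy
  have double {y : ℝ} (hy : |y| ≤ 1 / 10) : |2 * y| ≤ 1 / 4 := by
    rw [abs_mul, abs_two]
    linarith
  rw [shearletHat, norm_mul, norm_mul, norm_mul, mul_pow _ ‖scalingHat m₀ (2 * η 2)‖,
    mul_pow _ ‖scalingHat m₀ (2 * η 1)‖, mul_pow _ ‖scalingHat m₀ (η 0)‖]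
  gcongr
  · exact le_norm_highPass_sq hq hm₁ hL hε.le h₀ h₀'
  · exact scaling_ge (by linarith)
  · exact scaling_ge (double h₁)
  · exact scaling_ge (double h₂)

end ShearletHat

/-! ### Layers -/

section Layer

/-- One layer of a wavelet-type system on the Fourier side: the functions
`x ↦ |det B|^{1/2} ψ(B x - c m)`, `m ∈ ℤᵈ`, where `window` is the Fourier transform of `ψ`, `dual`
is the inverse transpose `N` of `B`, and `sampling` lists the diagonal entries of the sampling
matrix `c`. The function `envelope` measures how much of the layer is seen at a frequency. -/
structure Layer (d : Type*) where
  sampling : d → ℝ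
  dual : EuclideanSpace ℝ d →ₗ[ℝ] EuclideanSpace ℝ d
  window : EuclideanSpace ℝ d → ℂ
  envelope : EuclideanSpace ℝ d → ℝ≥0∞

namespace Layer

variable {d : Type*} (ℓ : Layer d)

/-- The function `F` seen through the window of the layer. -/
def localized (F : EuclideanSpace ℝ d → ℂ) (ξ : EuclideanSpace ℝ d) : ℂ :=
  conj (ℓ.window (ℓ.dual ξ)) * F ξ

theorem enorm_localized_sq (F : EuclideanSpace ℝ d → ℂ) (ξ : EuclideanSpace ℝ d) :
    ‖ℓ.localized F ξ‖ₑ ^ 2 = ‖ℓ.window (ℓ.dual ξ)‖ₑ ^ 2 * ‖F ξ‖ₑ ^ 2 := by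
  rw [localized, enorm_mul, mul_pow, RCLike.enorm_conj]

variable [Fintype d]

/-- The part of the `L²` mass of `F` that lies under the envelope of the layer. -/
def mass (F : EuclideanSpace ℝ d → ℂ) : ℝ≥0∞ := ∫⁻ ξ, ℓ.envelope (ℓ.dual ξ) * ‖F ξ‖ₑ ^ 2

/-- The layer is sampled at least as densely as `c₀ ≤ 1` prescribes, and its window is dominated
by its envelope, with an additional product decay. -/
structure IsDominated (c₀ : ℝ) : Prop where
  det_ne_zero : ℓ.dual.det ≠ 0
  sampling_pos : ∀ i, 0 < ℓ.sampling i
  sampling_le : ∀ i, ℓ.sampling i ≤ c₀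
  pos : 0 < c₀
  le_one : c₀ ≤ 1
  memLp_window : MemLp ℓ.window 2
  measurable_envelope : Measurable ℓ.envelope
  window_le : ∀ η, ‖ℓ.window η‖ₑ ^ 2 ≤ ℓ.envelope η * ENNReal.ofReal (∏ i, decay (η i))

variable {ℓ} {c₀ : ℝ} {R : ℝ≥0∞} {F : EuclideanSpace ℝ d → ℂ}

namespace IsDominated

theorem enorm_window_sq_le (h : ℓ.IsDominated c₀) (η : EuclideanSpace ℝ d) :
    ‖ℓ.window η‖ₑ ^ 2 ≤ ℓ.envelope η :=
  (h.window_le η).trans (mul_le_of_le_one_right' (ENNReal.ofReal_le_one.2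
    (Finset.prod_le_one (fun _ _ => (decay_pos _).le) fun _ _ => decay_le_one _)))

theorem measurable_envelope_dual (h : ℓ.IsDominated c₀) :
    Measurable fun ξ => ℓ.envelope (ℓ.dual ξ) :=
  h.measurable_envelope.comp ℓ.dual.toContinuousLinearMap.measurable

theorem memLp_window_dual (h : ℓ.IsDominated c₀) :
    MemLp (fun ξ => conj (ℓ.window (ℓ.dual ξ))) 2 :=
  (memLp_comp_of_det_ne_zero h.det_ne_zero h.memLp_window).star

theorem integrable_localized (h : ℓ.IsDominated c₀) (hF : MemLp F 2) :
    Integrable (ℓ.localized F) :=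
  h.memLp_window_dual.integrable_mul hF

theorem memLp_localized (h : ℓ.IsDominated c₀) (hR : R ≠ ∞)
    (hQ : ∀ ξ, ℓ.envelope (ℓ.dual ξ) ≤ R) (hF : MemLp F 2) : MemLp (ℓ.localized F) 2 := by
  refine hF.of_le_mul (c := √R.toReal) (h.memLp_window_dual.1.mul hF.1) (.of_forall fun ξ => ?_)
  rw [localized, norm_mul, RCLike.norm_conj]
  refine mul_le_mul_of_nonneg_right (Real.le_sqrt_of_sq_le ?_) (norm_nonneg _)
  have := ENNReal.toReal_mono hR ((h.enorm_window_sq_le _).trans (hQ ξ))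
  simpa using this

end IsDominated

variable [DecidableEq d] (ℓ)

/-- The linear map that takes the dual lattice of the layer to the integer points. -/
def toLattice : EuclideanSpace ℝ d →ₗ[ℝ] EuclideanSpace ℝ d :=
  Matrix.toEuclideanLin (Matrix.diagonal ℓ.sampling) ∘ₗ ℓ.dual

/-- The translation vector `c m` of the layer. -/
def translation (m : d → ℤ) : EuclideanSpace ℝ d :=
  Matrix.toEuclideanLin (Matrix.diagonal ℓ.sampling) (latticePoint m)

/-- The sum of the squared coefficients, in the layer, of the function with Fourier transform
`F`. -/
def energy (F : EuclideanSpace ℝ d → ℂ) : ℝ≥0∞ :=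
  ENNReal.ofReal |ℓ.dual.det| * ∑' m, ‖∫ ξ, sampled ℓ.toLattice (ℓ.localized F) m ξ‖ₑ ^ 2

theorem toLattice_apply (ξ : EuclideanSpace ℝ d) (i : d) :
    ℓ.toLattice ξ i = ℓ.sampling i * ℓ.dual ξ i := by
  simp [toLattice, Matrix.mulVec_diagonal]

theorem det_toLattice : ℓ.toLattice.det = (∏ i, ℓ.sampling i) * ℓ.dual.det := by
  rw [toLattice, LinearMap.det_comp, LinearMap.det_toLpLin, Matrix.det_diagonal]

theorem modulation_translation (m : d → ℤ) (ξ : EuclideanSpace ℝ d) :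
    modulation (ℓ.translation m) (ℓ.dual ξ) = modulation (latticePoint m) (ℓ.toLattice ξ) := by
  simp only [modulation, PiLp.inner_apply, toLattice_apply]
  simp [translation, Matrix.mulVec_diagonal, mul_left_comm, mul_assoc]

variable {ℓ}

namespace IsDominated

theorem det_toLattice_ne_zero (h : ℓ.IsDominated c₀) : ℓ.toLattice.det ≠ 0 := by
  rw [det_toLattice]
  exact mul_ne_zero (Finset.prod_ne_zero_iff.2 fun i _ => (h.sampling_pos i).ne') h.det_ne_zero

theorem latticeEnergy_localized (h : ℓ.IsDominated c₀) (F : EuclideanSpace ℝ d → ℂ) :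
    latticeEnergy ℓ.toLattice (ℓ.localized F) =
      ENNReal.ofReal (∏ i, ℓ.sampling i) * ℓ.energy F := by
  have hpos : 0 ≤ ∏ i, ℓ.sampling i := Finset.prod_nonneg fun i _ => (h.sampling_pos i).le
  rw [latticeEnergy, energy, det_toLattice, abs_mul, abs_of_nonneg hpos, ENNReal.ofReal_mul hpos,
    mul_assoc]

theorem latticeEnergy_localized_le (h : ℓ.IsDominated c₀) (F : EuclideanSpace ℝ d → ℂ) :
    latticeEnergy ℓ.toLattice (ℓ.localized F) ≤ ℓ.energy F := by
  rw [h.latticeEnergy_localized]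
  refine mul_le_of_le_one_left' (ENNReal.ofReal_le_one.2 ?_)
  exact Finset.prod_le_one (fun i _ => (h.sampling_pos i).le) fun i _ =>
    (h.sampling_le i).trans h.le_one

theorem enorm_localized_sq_le (h : ℓ.IsDominated c₀) (F : EuclideanSpace ℝ d → ℂ) {n : d → ℤ}
    (hn : n ≠ 0) {ξ : EuclideanSpace ℝ d} (hξ : ℓ.toLattice ξ ∈ latticeCube n) :
    ‖ℓ.localized F ξ‖ₑ ^ 2 ≤ latticeWeight n *
      (ENNReal.ofReal (c₀ ^ 2) * (ℓ.envelope (ℓ.dual ξ) * ‖F ξ‖ₑ ^ 2)) := by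
  have hdecay := prod_decay_le_sq_mul_latticeWeight hn h.sampling_pos h.sampling_le h.le_one
    fun i => ℓ.toLattice_apply ξ i ▸ abs_sub_le_half_of_mem_latticeCube hξ i
  calc ‖ℓ.localized F ξ‖ₑ ^ 2
      ≤ ℓ.envelope (ℓ.dual ξ) * (ENNReal.ofReal (c₀ ^ 2) * latticeWeight n) * ‖F ξ‖ₑ ^ 2 := by
        rw [enorm_localized_sq]
        gcongr
        exact (h.window_le _).trans (by gcongr)
    _ = _ := by ring

theorem latticeEnergy_le (h : ℓ.IsDominated c₀) (hR : R ≠ ∞)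
    (hQ : ∀ ξ, ℓ.envelope (ℓ.dual ξ) ≤ R) (hF : MemLp F 2) :
    latticeEnergy ℓ.toLattice (ℓ.localized F) ≤
      2 * (1 + ∑' n : d → ℤ, latticeWeight n) * ℓ.mass F := by
  have hcell : ∫⁻ ξ in ℓ.toLattice ⁻¹' latticeCube 0, ‖ℓ.localized F ξ‖ₑ ^ 2 ≤ ℓ.mass F := by
    refine (setLIntegral_le_lintegral _ _).trans (lintegral_mono fun ξ => ?_)
    rw [enorm_localized_sq]
    gcongr
    exact h.enorm_window_sq_le _
  have hremainder : ∫⁻ ξ, ENNReal.ofReal (c₀ ^ 2) * (ℓ.envelope (ℓ.dual ξ) * ‖F ξ‖ₑ ^ 2) ≤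
      ℓ.mass F :=
    lintegral_mono fun ξ => mul_le_of_le_one_left'
      (ENNReal.ofReal_le_one.2 (pow_le_one₀ h.pos.le h.le_one))
  refine (Shearlet.latticeEnergy_le h.det_toLattice_ne_zero (h.integrable_localized hF)
    (h.memLp_localized hR hQ hF) latticeWeight_ne_zero latticeWeight_ne_top
    fun n hn ξ hξ => h.enorm_localized_sq_le F hn hξ).trans ?_
  rw [mul_assoc, add_mul, one_mul]
  gcongr

theorem setLIntegral_enorm_localized_sq_le (h : ℓ.IsDominated c₀) (hR : R ≠ ∞)
    (hQ : ∀ ξ, ℓ.envelope (ℓ.dual ξ) ≤ R) (hF : MemLp F 2) :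
    ∫⁻ ξ in ℓ.toLattice ⁻¹' latticeCube 0, ‖ℓ.localized F ξ‖ₑ ^ 2 ≤
      2 * (ℓ.energy F + ENNReal.ofReal (c₀ ^ 2) * (∑' n : d → ℤ, latticeWeight n) * ℓ.mass F) := by
  refine (lintegral_preimage_latticeCube_le h.det_toLattice_ne_zero (h.integrable_localized hF)
    (h.memLp_localized hR hQ hF) latticeWeight_ne_zero latticeWeight_ne_top
    fun n hn ξ hξ => h.enorm_localized_sq_le F hn hξ).trans ?_
  rw [lintegral_const_mul' _ _ ENNReal.ofReal_ne_top, ← mass, mul_left_comm, mul_assoc]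
  gcongr
  exact h.latticeEnergy_localized_le F

end IsDominated

end Layer

end Layer

/-! ### Frames made of layers -/

section LayerFrame

variable {d : Type*} [Fintype d] {ι κ : Type*}

namespace Layer

variable {ℓ : ι → Layer d} {c₀ : ℝ} {A R v : ℝ≥0∞} {F : EuclideanSpace ℝ d → ℂ}

theorem tsum_mass_le [Countable ι] (hℓ : ∀ p, (ℓ p).IsDominated c₀)
    (hR : ∀ ξ, ∑' p, (ℓ p).envelope ((ℓ p).dual ξ) ≤ R) (hF : MemLp F 2) :
    ∑' p, (ℓ p).mass F ≤ R * ∫⁻ ξ, ‖F ξ‖ₑ ^ 2 := by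
  have hFm : AEMeasurable fun ξ => ‖F ξ‖ₑ ^ 2 := hF.1.enorm.pow_const 2
  calc ∑' p, (ℓ p).mass F
      = ∫⁻ ξ, (∑' p, (ℓ p).envelope ((ℓ p).dual ξ)) * ‖F ξ‖ₑ ^ 2 := by
        simp only [mass, ← ENNReal.tsum_mul_right]
        exact (lintegral_tsum fun p =>
          (hℓ p).measurable_envelope_dual.aemeasurable.mul hFm).symm
    _ ≤ R * ∫⁻ ξ, ‖F ξ‖ₑ ^ 2 := by
        rw [← lintegral_const_mul'' R hFm]
        exact lintegral_mono fun ξ => mul_le_mul_left (hR ξ) _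

variable [DecidableEq d]

/-- The layer covers `ξ` at level `A`: the frequency lies in the central cell of the dual lattice,
where the window has squared modulus at least `A`. -/
def Covers (ℓ : Layer d) (A : ℝ≥0∞) (ξ : EuclideanSpace ℝ d) : Prop :=
  ℓ.toLattice ξ ∈ latticeCube 0 ∧ A ≤ ‖ℓ.window (ℓ.dual ξ)‖ₑ ^ 2

theorem Covers.mono {ℓ : Layer d} {B : ℝ≥0∞} {ξ : EuclideanSpace ℝ d} (h : ℓ.Covers B ξ)
    (hAB : A ≤ B) : ℓ.Covers A ξ :=
  ⟨h.1, hAB.trans h.2⟩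

theorem IsDominated.covers {ℓ : Layer d} (hℓ : ℓ.IsDominated c₀) {ξ : EuclideanSpace ℝ d}
    (hξ : ∀ i, |ℓ.dual ξ i| < 1 / 2) (hA : A ≤ ‖ℓ.window (ℓ.dual ξ)‖ₑ ^ 2) : ℓ.Covers A ξ := by
  refine ⟨fun i => ?_, hA⟩
  have hlt : |ℓ.toLattice ξ i| < 1 / 2 := by
    rw [toLattice_apply, abs_mul, abs_of_pos (hℓ.sampling_pos i)]
    exact (mul_le_of_le_one_left (abs_nonneg _) ((hℓ.sampling_le i).trans hℓ.le_one)).trans_lt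
      (hξ i)
  obtain ⟨hleft, hright⟩ := abs_lt.1 hlt
  constructor <;> norm_num <;> linarith

variable [Countable ι]

theorem mul_lintegral_le_tsum_setLIntegral (hℓ : ∀ p, (ℓ p).IsDominated c₀) (hF : MemLp F 2)
    (hcover : ∀ᵐ ξ, F ξ ≠ 0 → ∃ p, (ℓ p).Covers A ξ) :
    A * ∫⁻ ξ, ‖F ξ‖ₑ ^ 2 ≤
      ∑' p, ∫⁻ ξ in (ℓ p).toLattice ⁻¹' latticeCube 0, ‖(ℓ p).localized F ξ‖ₑ ^ 2 := by
  have hcell : ∀ p, MeasurableSet ((ℓ p).toLattice ⁻¹' latticeCube 0) := fun p =>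
    measurableSet_preimage_latticeCube _ 0
  have hmeas : ∀ p, AEMeasurable (((ℓ p).toLattice ⁻¹' latticeCube 0).indicator
      fun ξ => ‖(ℓ p).localized F ξ‖ₑ ^ 2) := fun p =>
    (((hℓ p).integrable_localized hF).1.enorm.pow_const 2).indicator (hcell p)
  simp only [← lintegral_indicator (hcell _)]
  rw [← lintegral_tsum hmeas, ← lintegral_const_mul'' A (hF.1.enorm.pow_const 2)]
  refine lintegral_mono_ae (hcover.mono fun ξ hξ => ?_)
  by_cases hzero : F ξ = 0
  · simp [hzero]
  obtain ⟨p, hp, hA⟩ := hξ hzero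
  refine le_trans ?_ (ENNReal.le_tsum p)
  rw [Set.indicator_of_mem (Set.mem_preimage.2 hp), enorm_localized_sq]
  gcongr

theorem tsum_energy_le (hℓ : ∀ p, (ℓ p).IsDominated c₀) (hR₀ : R ≠ ∞)
    (hR : ∀ ξ, ∑' p, (ℓ p).envelope ((ℓ p).dual ξ) ≤ R)
    (hv : ∀ p, v ≤ ENNReal.ofReal (∏ i, (ℓ p).sampling i)) (hF : MemLp F 2) :
    v * ∑' p, (ℓ p).energy F ≤
      2 * (1 + ∑' n : d → ℤ, latticeWeight n) * (R * ∫⁻ ξ, ‖F ξ‖ₑ ^ 2) := by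
  calc v * ∑' p, (ℓ p).energy F
      ≤ ∑' p, 2 * (1 + ∑' n : d → ℤ, latticeWeight n) * (ℓ p).mass F := by
        rw [← ENNReal.tsum_mul_left]
        refine ENNReal.tsum_le_tsum fun p => (mul_le_mul_left (hv p) _).trans ?_
        rw [← (hℓ p).latticeEnergy_localized]
        exact (hℓ p).latticeEnergy_le hR₀ (fun ξ => (ENNReal.le_tsum p).trans (hR ξ)) hF
    _ ≤ _ := by
        rw [ENNReal.tsum_mul_left]
        gcongr
        exact tsum_mass_le hℓ hR hF

theorem mul_lintegral_le_tsum_energy (hℓ : ∀ p, (ℓ p).IsDominated c₀) (hR₀ : R ≠ ∞)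
    (hR : ∀ ξ, ∑' p, (ℓ p).envelope ((ℓ p).dual ξ) ≤ R) (hA : A ≠ ∞)
    (hsmall : 4 * (ENNReal.ofReal (c₀ ^ 2) * ((∑' n : d → ℤ, latticeWeight n) * R)) ≤ A)
    (hF : MemLp F 2) (hcover : ∀ᵐ ξ, F ξ ≠ 0 → ∃ p, (ℓ p).Covers A ξ) :
    A * ∫⁻ ξ, ‖F ξ‖ₑ ^ 2 ≤ 4 * ∑' p, (ℓ p).energy F := by
  set S := ∑' n : d → ℤ, latticeWeight n
  set I := ∫⁻ ξ, ‖F ξ‖ₑ ^ 2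
  have hfinite : A * I ≠ ∞ := ENNReal.mul_ne_top hA (by
    simpa using (lintegral_rpow_enorm_lt_top_of_eLpNorm_lt_top two_ne_zero (by simp) hF.2).ne)
  have hbound : A * I ≤ 2 * (∑' p, (ℓ p).energy F + ENNReal.ofReal (c₀ ^ 2) * S * (R * I)) := by
    refine (mul_lintegral_le_tsum_setLIntegral hℓ hF hcover).trans
      ((ENNReal.tsum_le_tsum fun p => (hℓ p).setLIntegral_enorm_localized_sq_le hR₀
        (fun ξ => (ENNReal.le_tsum p).trans (hR ξ)) hF).trans ?_)
    rw [ENNReal.tsum_mul_left, ENNReal.tsum_add, ENNReal.tsum_mul_left]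
    gcongr
    exact tsum_mass_le hℓ hR hF
  refine (ENNReal.add_le_add_iff_right hfinite).1 ?_
  calc A * I + A * I
      ≤ 2 * (∑' p, (ℓ p).energy F + ENNReal.ofReal (c₀ ^ 2) * S * (R * I)) +
          2 * (∑' p, (ℓ p).energy F + ENNReal.ofReal (c₀ ^ 2) * S * (R * I)) := by gcongr
    _ = 4 * ∑' p, (ℓ p).energy F + 4 * (ENNReal.ofReal (c₀ ^ 2) * (S * R)) * I := by ring
    _ ≤ 4 * ∑' p, (ℓ p).energy F + A * I := by gcongr

end Layer

variable [DecidableEq d]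

/-- The functions `g q` are square integrable, and their squared coefficients add up to the
energies in the layers `ℓ p`. -/
def HasLayers (g : κ → EuclideanSpace ℝ d → ℂ) (ℓ : ι → Layer d) : Prop :=
  ∃ hg : ∀ q, MemLp (g q) 2, ∀ f : Lp ℂ 2 (volume : Measure (EuclideanSpace ℝ d)),
    ∑' q, ‖inner ℂ ((hg q).toLp (g q)) f‖ₑ ^ 2 =
      ∑' p, (ℓ p).energy (𝓕 f : Lp ℂ 2 (volume : Measure (EuclideanSpace ℝ d)))

theorem HasLayers.sumElim {ι' κ' : Type*} {g : κ → EuclideanSpace ℝ d → ℂ} {ℓ : ι → Layer d}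
    {g' : κ' → EuclideanSpace ℝ d → ℂ} {ℓ' : ι' → Layer d} (h : HasLayers g ℓ)
    (h' : HasLayers g' ℓ') : HasLayers (Sum.elim g g') (Sum.elim ℓ ℓ') := by
  obtain ⟨hg, hsum⟩ := h
  obtain ⟨hg', hsum'⟩ := h'
  refine ⟨Sum.rec hg hg', fun f => ?_⟩
  rw [Summable.tsum_sum ENNReal.summable ENNReal.summable,
    Summable.tsum_sum ENNReal.summable ENNReal.summable]
  exact congrArg₂ (· + ·) (hsum f) (hsum' f)

theorem hasLayers_of_equiv {ℓ : ι → Layer d} {g : κ → EuclideanSpace ℝ d → ℂ}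
    {ψ : ι → EuclideanSpace ℝ d → ℂ} {a : ι → ℂ}
    {B : ι → EuclideanSpace ℝ d →ₗ[ℝ] EuclideanSpace ℝ d}
    (hψ : ∀ p, HasL2Fourier (ψ p) (ℓ p).window) (hw₁ : ∀ p, Integrable (ℓ p).window)
    (hw₂ : ∀ p, MemLp (ℓ p).window 2) (hB : ∀ p ξ x, ⟪(ℓ p).dual ξ, B p x⟫ = ⟪ξ, x⟫)
    (ha : ∀ p, ‖a p‖ₑ ^ 2 * ENNReal.ofReal |(ℓ p).dual.det| = 1) (e : ι × (d → ℤ) ≃ κ)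
    (hg : ∀ p m x, g (e (p, m)) x = a p * ψ p (B p x - (ℓ p).translation m)) :
    HasLayers g ℓ := by
  have hfourier : ∀ p m, HasL2Fourier (g (e (p, m))) _ := fun p m => by
    rw [funext (hg p m)]
    exact ((hψ p).comp_linear_sub (hw₁ p) (hw₂ p) (hB p) ((ℓ p).translation m)).const_mul (a p)
  have hmem : ∀ q, MemLp (g q) 2 := fun q => e.apply_symm_apply q ▸ (hfourier _ _).1
  refine ⟨hmem, fun f => ?_⟩
  rw [← e.tsum_eq, ENNReal.tsum_prod']
  refine tsum_congr fun p => ?_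
  rw [Layer.energy, ← ENNReal.tsum_mul_left]
  refine tsum_congr fun m => ?_
  have hcoeff : inner ℂ ((hmem (e (p, m))).toLp _) f = conj (a p) * (|(ℓ p).dual.det| : ℝ) *
      ∫ ξ, sampled (ℓ p).toLattice
        ((ℓ p).localized (𝓕 f : Lp ℂ 2 (volume : Measure (EuclideanSpace ℝ d)))) m ξ := by
    rw [(hfourier p m).inner_toLp, ← integral_const_mul]
    refine integral_congr_ae (.of_forall fun ξ => ?_)
    simp only [sampled, Layer.localized, Layer.modulation_translation, map_mul,
      Complex.conj_ofReal]
    ring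
  have hdet : ‖((|(ℓ p).dual.det| : ℝ) : ℂ)‖ₑ = ENNReal.ofReal |(ℓ p).dual.det| := by
    rw [← ofReal_norm, Complex.norm_real, Real.norm_eq_abs, abs_abs]
  rw [hcoeff, enorm_mul, enorm_mul, RCLike.enorm_conj, hdet, mul_pow, mul_pow,
    sq (ENNReal.ofReal _), ← mul_assoc (‖a p‖ₑ ^ 2), ha, one_mul]

theorem isFrameOn_of_enorm_bounds {H : Type*} [NormedAddCommGroup H] [InnerProductSpace ℂ H]
    [Countable κ] {V : Set H} {u : κ → H} {a b : ℝ≥0∞} (ha₀ : a ≠ 0) (ha : a ≠ ∞) (hb : b ≠ ∞)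
    (hlower : ∀ f ∈ V, a * ‖f‖ₑ ^ 2 ≤ ∑' q, ‖inner ℂ (u q) f‖ₑ ^ 2)
    (hupper : ∀ f ∈ V, ∑' q, ‖inner ℂ (u q) f‖ₑ ^ 2 ≤ b * ‖f‖ₑ ^ 2) : IsFrameOn V u := by
  lift a to NNReal using ha
  lift b to NNReal using hb
  have hpos : 0 < a := pos_iff_ne_zero.2 (mod_cast ha₀)
  refine ⟨inferInstance, a, max a b, mod_cast hpos, le_max_left _ _, fun f hf => ?_⟩
  have hlower := hlower f hf
  have hupper := (hupper f hf).trans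
    (mul_le_mul_left (ENNReal.coe_le_coe.2 (le_max_right a b)) _)
  have hsum : Summable fun q => ‖inner ℂ (u q) f‖₊ ^ 2 := by
    rw [← ENNReal.tsum_coe_ne_top_iff_summable]
    exact ne_top_of_le_ne_top (by finiteness) hupper
  simp only [enorm_eq_nnnorm, ← ENNReal.coe_pow, ← ENNReal.coe_mul, ← ENNReal.coe_tsum hsum,
    ENNReal.coe_le_coe, ← NNReal.coe_le_coe] at hlower hupper
  push_cast at hlower hupper
  exact ⟨by simpa using NNReal.summable_coe.2 hsum, hlower, hupper⟩

theorem isL2FrameOn_of_hasLayers [Countable ι] [Countable κ] {V : Set L2R3} {g : κ → R3 → ℂ}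
    {ℓ : ι → Layer (Fin 3)} {c₀ : ℝ} {A R v : ℝ≥0∞} (h : HasLayers g ℓ)
    (hℓ : ∀ p, (ℓ p).IsDominated c₀) (hR₀ : R ≠ ∞)
    (hR : ∀ ξ, ∑' p, (ℓ p).envelope ((ℓ p).dual ξ) ≤ R) (hA₀ : A ≠ 0) (hA : A ≠ ∞)
    (hsmall : 4 * (ENNReal.ofReal (c₀ ^ 2) *
      ((∑' n : Fin 3 → ℤ, latticeWeight n) * R)) ≤ A) (hv₀ : v ≠ 0)
    (hv : ∀ p, v ≤ ENNReal.ofReal (∏ i, (ℓ p).sampling i))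
    (hcover : ∀ f ∈ V, ∀ᵐ ξ, (𝓕 f : L2R3) ξ ≠ 0 → ∃ p, (ℓ p).Covers A ξ) :
    IsL2FrameOn V g := by
  obtain ⟨hg, hsum⟩ := h
  have hS := tsum_latticeWeight_ne_top (d := Fin 3)
  have hB : 2 * (1 + ∑' n : Fin 3 → ℤ, latticeWeight n) * R / v ≠ ∞ :=
    ENNReal.div_ne_top (by finiteness) hv₀
  refine ⟨hg, isFrameOn_of_enorm_bounds (a := A / 4) (ENNReal.div_ne_zero.2 ⟨hA₀, by norm_num⟩)
    (ENNReal.div_ne_top hA four_ne_zero) hB (fun f hf => ?_) fun f _ => ?_⟩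
  · rw [hsum, ← lintegral_fourier_enorm_sq, ENNReal.div_eq_inv_mul, mul_assoc,
      ← ENNReal.div_eq_inv_mul]
    exact ENNReal.div_le_of_le_mul'
      (Layer.mul_lintegral_le_tsum_energy hℓ hR₀ hR hA hsmall (Lp.memLp _) (hcover f hf))
  · rw [hsum, ENNReal.mul_comm_div, ← mul_div_assoc, ENNReal.le_div_iff_mul_le (.inl hv₀)
      (.inr (by finiteness)), ← lintegral_fourier_enorm_sq, mul_comm]
    simpa only [mul_assoc] using Layer.tsum_energy_le hℓ hR₀ hR hv (Lp.memLp _)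

theorem exists_ofReal_sq_mul_le {M A : ℝ≥0∞} (hM : M ≠ ∞) (hA : A ≠ 0) :
    ∃ c₀ : ℝ, 0 < c₀ ∧ c₀ ≤ 1 ∧ 4 * (ENNReal.ofReal (c₀ ^ 2) * M) ≤ A := by
  have hlim : Tendsto (fun c : ℝ => 4 * (ENNReal.ofReal (c ^ 2) * M)) (𝓝[>] 0) (𝓝 0) := by
    have hsq : Tendsto (fun c : ℝ => ENNReal.ofReal (c ^ 2)) (𝓝[>] 0) (𝓝 0) := by
      refine ((ENNReal.continuous_ofReal.comp (continuous_pow 2)).tendsto' 0 0 ?_).mono_left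
        nhdsWithin_le_nhds
      simp
    simpa using ENNReal.Tendsto.const_mul (a := 4) (ENNReal.Tendsto.mul_const hsq (.inr hM))
      (.inr (by simp))
  have hmem : Set.Ioc (0 : ℝ) 1 ∈ 𝓝[>] (0 : ℝ) := Ioc_mem_nhdsGT one_pos
  obtain ⟨c₀, hle, hpos, hone⟩ :=
    ((hlim.eventually_le_const (pos_iff_ne_zero.2 hA)).and hmem).exists
  exact ⟨c₀, hpos, hone, hle⟩

end LayerFrame

/-! ### The frequency cones -/

section Cones

/-- The scale and shear parameters `(j, k₁, k₂)` of a shearlet system. -/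
abbrev ShearParam (α : ℝ) : Type :=
  {p : ℕ × ℤ × ℤ //
    |p.2.1| ≤ ⌈(2 : ℝ) ^ (p.1 * (α - 1) / 2)⌉ ∧ |p.2.2| ≤ ⌈(2 : ℝ) ^ (p.1 * (α - 1) / 2)⌉}

/-- The inverse transpose of the matrix `S_k A_{2^j}`. -/
def dualMat (α : ℝ) (p : ℕ × ℤ × ℤ) : Matrix (Fin 3) (Fin 3) ℝ :=
  !![((2 : ℝ) ^ (p.1 * α / 2))⁻¹, 0, 0;
    -(p.2.1 * ((2 : ℝ) ^ (p.1 * α / 2))⁻¹), ((2 : ℝ) ^ ((p.1 : ℝ) / 2))⁻¹, 0;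
    -(p.2.2 * ((2 : ℝ) ^ (p.1 * α / 2))⁻¹), 0, ((2 : ℝ) ^ ((p.1 : ℝ) / 2))⁻¹]

theorem det_dualMat (α : ℝ) (p : ℕ × ℤ × ℤ) :
    (dualMat α p).det = (((2 : ℝ) ^ (p.1 * (α + 2) / 4)) ^ 2)⁻¹ := by
  have hpow : ((2 : ℝ) ^ (p.1 * (α + 2) / 4)) ^ 2 =
      (2 : ℝ) ^ (p.1 * α / 2) * ((2 : ℝ) ^ ((p.1 : ℝ) / 2)) ^ 2 := by
    rw [← Real.rpow_mul_natCast (by norm_num), ← Real.rpow_mul_natCast (by norm_num),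
      ← Real.rpow_add (by norm_num)]
    congr 1
    push_cast
    ring
  simp only [dualMat, Matrix.det_fin_three, Matrix.of_apply, Matrix.cons_val]
  rw [hpow, mul_inv]
  ring

theorem rpow_neg_half_pow (α : ℝ) (j : ℕ) :
    ((2 : ℝ) ^ (-(α / 2))) ^ j = ((2 : ℝ) ^ (j * α / 2))⁻¹ := by
  rw [← Real.rpow_mul_natCast (by norm_num), ← Real.rpow_neg (by norm_num)]
  congr 1
  ring

theorem ofLp_toEuclideanLin_dualMat (α : ℝ) (p : ℕ × ℤ × ℤ) (ξ : R3) :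
    (Matrix.toEuclideanLin (dualMat α p) ξ).ofLp =
      ![((2 : ℝ) ^ (-(α / 2))) ^ p.1 * ξ 0,
        ((2 : ℝ) ^ ((p.1 : ℝ) / 2))⁻¹ * ξ 1 - p.2.1 * (((2 : ℝ) ^ (-(α / 2))) ^ p.1 * ξ 0),
        ((2 : ℝ) ^ ((p.1 : ℝ) / 2))⁻¹ * ξ 2 - p.2.2 * (((2 : ℝ) ^ (-(α / 2))) ^ p.1 * ξ 0)] := by
  rw [rpow_neg_half_pow]
  ext i
  fin_cases i <;> simp [dualMat, Matrix.mulVec, dotProduct, Fin.sum_univ_three] <;> ring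

/-- The radius of the low frequency box. One scaling step divides the first coordinate by
`2^{α/2}`, so every larger value of `|ξ₁|` is moved into `[innerRadius α, 1/5]`. -/
def innerRadius (α : ℝ) : ℝ := 2 ^ (-(α / 2)) * (1 / 5)

theorem innerRadius_pos (α : ℝ) : 0 < innerRadius α := by
  unfold innerRadius
  positivity

theorem innerRadius_le {α : ℝ} (hα : 0 ≤ α) : innerRadius α ≤ 1 / 5 := by
  have := Real.rpow_le_one_of_one_le_of_nonpos one_le_two (by linarith : -(α / 2) ≤ 0)
  unfold innerRadius
  linarith

/-- The frequency cone around the first axis, cut off at distance `innerRadius α`. -/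
def cone (α : ℝ) : Set R3 := {ξ | innerRadius α ≤ |ξ 0| ∧ |ξ 1| ≤ |ξ 0| ∧ |ξ 2| ≤ |ξ 0|}

theorem pyramid_subset_cone {α : ℝ} (hα : 0 ≤ α) : pyramid ⊆ cone α := by
  have mem_cone {ξ : R3} (h₀ : 1 ≤ |ξ 0|) (h₁ : |ξ 1 / ξ 0| ≤ 1) (h₂ : |ξ 2 / ξ 0| ≤ 1) :
      ξ ∈ cone α := by
    have hpos : 0 < |ξ 0| := by linarith
    rw [abs_div, div_le_one hpos] at h₁ h₂
    exact ⟨by linarith [innerRadius_le hα], h₁, h₂⟩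
  rintro ξ (⟨h₀, h₁, h₂⟩ | ⟨h₀, h₁, h₂⟩)
  · exact mem_cone (h₀.trans (le_abs_self _)) h₁ h₂
  · exact mem_cone (by rw [abs_of_neg (by linarith)]; linarith) h₁ h₂

theorem abs_round_le_ceil {t e : ℝ} (h : |t| ≤ e) : |round t| ≤ ⌈e⌉ := by
  have hround : |(round t : ℝ)| < ⌈e⌉ + 1 := by
    calc |(round t : ℝ)| = |t - (t - round t)| := by rw [sub_sub_cancel]
      _ ≤ |t| + |t - round t| := abs_sub _ _
      _ < ⌈e⌉ + 1 := by linarith [Int.le_ceil e, abs_sub_round t]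
  exact Int.lt_add_one_iff.1 (by exact_mod_cast hround)

theorem abs_sub_round_div_mul_le (x : ℝ) {y : ℝ} (hy : y ≠ 0) :
    |x - round (x / y) * y| ≤ |y| / 2 := by
  have hxy : x - round (x / y) * y = (x / y - round (x / y)) * y := by field_simp
  rw [hxy, abs_mul]
  exact (mul_le_mul_of_nonneg_right (abs_sub_round _) (abs_nonneg y)).trans_eq (by ring)

theorem exists_pow_mul_mem_Icc {ρ x : ℝ} (hρ₀ : 0 < ρ) (hρ₁ : ρ < 1) {a : ℝ} (ha : 0 < a)
    (hx : ρ * a ≤ x) : ∃ j : ℕ, ρ ^ j * x ∈ Set.Icc (ρ * a) a := by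
  obtain ⟨j, hj, hj'⟩ := exists_nat_pow_near (x := x / (ρ * a)) (y := ρ⁻¹)
    ((one_le_div (by positivity)).2 hx) ((one_lt_inv₀ hρ₀).2 hρ₁)
  rw [inv_pow, le_div_iff₀ (by positivity), inv_mul_le_iff₀ (by positivity)] at hj
  rw [inv_pow, div_lt_iff₀ (by positivity), pow_succ, lt_inv_mul_iff₀ (by positivity)] at hj'
  exact ⟨j, hj, le_of_mul_le_mul_left (by linarith) hρ₀⟩

theorem exists_shearParam {α : ℝ} (hα : 0 < α) {ξ : R3} (hξ : ξ ∈ cone α) :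
    ∃ p : ShearParam α,
      innerRadius α ≤ |Matrix.toEuclideanLin (dualMat α p) ξ 0| ∧
      |Matrix.toEuclideanLin (dualMat α p) ξ 0| ≤ 1 / 5 ∧
      |Matrix.toEuclideanLin (dualMat α p) ξ 1| ≤ 1 / 10 ∧
      |Matrix.toEuclideanLin (dualMat α p) ξ 2| ≤ 1 / 10 := by
  obtain ⟨h₀, h₁, h₂⟩ := hξ
  obtain ⟨j, hj⟩ := exists_pow_mul_mem_Icc (ρ := 2 ^ (-(α / 2))) (x := |ξ 0|) (by positivity)
    (Real.rpow_lt_one_of_one_lt_of_neg one_lt_two (by linarith)) (a := 1 / 5) (by norm_num)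
    h₀
  set ρ : ℝ := 2 ^ (-(α / 2)) with hρ
  set b : ℝ := ((2 : ℝ) ^ ((j : ℝ) / 2))⁻¹ with hb
  set y : ℝ := ρ ^ j * ξ 0 with hy
  have hb₀ : 0 < b := by positivity
  have hρj : 0 < ρ ^ j := by positivity
  have habs : |y| = ρ ^ j * |ξ 0| := by rw [hy, abs_mul, abs_of_pos hρj]
  rw [← habs] at hj
  have hinner : innerRadius α ≤ |y| := hj.1
  have hy₀ : 0 < |y| := (innerRadius_pos α).trans_le hinner
  have hslope : b = 2 ^ (j * (α - 1) / 2) * ρ ^ j := by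
    rw [hb, hρ, rpow_neg_half_pow, ← Real.rpow_neg (by norm_num), ← Real.rpow_neg (by norm_num),
      ← Real.rpow_add (by norm_num)]
    congr 1
    ring
  have hshear {x : ℝ} (hx : |x| ≤ |ξ 0|) : |round (b * x / y)| ≤ ⌈(2 : ℝ) ^ (j * (α - 1) / 2)⌉ := by
    refine abs_round_le_ceil ?_
    rw [abs_div, abs_mul, abs_of_pos hb₀, div_le_iff₀ hy₀, habs, hslope, mul_assoc]
    gcongr
  have hbox (x : ℝ) : |b * x - round (b * x / y) * y| ≤ 1 / 10 :=
    (abs_sub_round_div_mul_le _ (abs_pos.1 hy₀)).trans (by linarith [hj.2])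
  refine ⟨⟨(j, round (b * ξ 1 / y), round (b * ξ 2 / y)), hshear h₁, hshear h₂⟩, ?_⟩
  simp only [ofLp_toEuclideanLin_dualMat, Matrix.cons_val]
  exact ⟨hinner, hj.2, hbox _, hbox _⟩

/-- The permutation matrix exchanging the first two coordinates. -/
def perm12 : Matrix (Fin 3) (Fin 3) ℝ := !![0, 1, 0; 1, 0, 0; 0, 0, 1]

/-- The permutation matrix exchanging the first and the last coordinate. -/
def perm13 : Matrix (Fin 3) (Fin 3) ℝ := !![0, 0, 1; 0, 1, 0; 1, 0, 0]

theorem transpose_perm12_mul : perm12.transpose * perm12 = 1 := by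
  ext i j
  fin_cases i <;> fin_cases j <;> simp [perm12, Matrix.mul_apply, Fin.sum_univ_three]

theorem transpose_perm13_mul : perm13.transpose * perm13 = 1 := by
  ext i j
  fin_cases i <;> fin_cases j <;> simp [perm13, Matrix.mul_apply, Fin.sum_univ_three]

theorem toEuclideanLin_perm12 (ξ : R3) : Matrix.toEuclideanLin perm12 ξ = !₂[ξ 1, ξ 0, ξ 2] := by
  ext i
  fin_cases i <;> simp [perm12, Matrix.mulVec, dotProduct, Fin.sum_univ_three]

theorem toEuclideanLin_perm13 (ξ : R3) : Matrix.toEuclideanLin perm13 ξ = !₂[ξ 2, ξ 1, ξ 0] := by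
  ext i
  fin_cases i <;> simp [perm13, Matrix.mulVec, dotProduct, Fin.sum_univ_three]

theorem mem_box_or_cones (α : ℝ) (ξ : R3) :
    (∀ i, |ξ i| ≤ innerRadius α) ∨ Matrix.toEuclideanLin 1 ξ ∈ cone α ∨
      Matrix.toEuclideanLin perm12 ξ ∈ cone α ∨ Matrix.toEuclideanLin perm13 ξ ∈ cone α := by
  simp only [cone, Set.mem_ofPred_eq, toEuclideanLin_perm12, toEuclideanLin_perm13,
    Matrix.toLpLin_one, LinearMap.id_apply, Matrix.cons_val, Fin.forall_fin_succ,
    Fin.forall_fin_zero]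
  grind

end Cones

/-! ### The layers of the pyramid-adapted system -/

section PyramidLayers

/-- What the frame argument uses about the Fourier transform `W` of the generator of a shearlet
system: an upper bound with vanishing moments and decay, and a lower bound on the box into which
scaling and shearing move the cone. -/
structure IsShearletWindow (α C A : ℝ) (W : R3 → ℂ) : Prop where
  integrable : Integrable W
  memLp : MemLp W 2
  norm_sq_le : ∀ η, ‖W η‖ ^ 2 ≤ C * majorant η.ofLp * ∏ i, decay (η i)
  le_norm_sq : ∀ η, innerRadius α ≤ |η 0| → |η 0| ≤ 1 / 5 → |η 1| ≤ 1 / 10 → |η 2| ≤ 1 / 10 →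
    A ≤ ‖W η‖ ^ 2

/-- What the frame argument uses about the Fourier transform `Φ` of the scaling function. -/
structure IsScalingWindow (α C A : ℝ) (Φ : R3 → ℂ) : Prop where
  integrable : Integrable Φ
  memLp : MemLp Φ 2
  norm_sq_le : ∀ η, ‖Φ η‖ ^ 2 ≤ C * ∏ i, decay (η i)
  le_norm_sq : ∀ η, (∀ i, |η i| ≤ innerRadius α) → A ≤ ‖Φ η‖ ^ 2

/-- The layer of scale and shear `p` of a shearlet system with sampling `(c₁, c₂, c₂)`, after the
change of coordinates `P`. -/
def shearLayer (α c₁ c₂ C : ℝ) (W : R3 → ℂ) (P : Matrix (Fin 3) (Fin 3) ℝ) (p : ShearParam α) :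
    Layer (Fin 3) where
  sampling := ![c₁, c₂, c₂]
  dual := Matrix.toEuclideanLin (dualMat α p) ∘ₗ Matrix.toEuclideanLin P
  window := W
  envelope η := ENNReal.ofReal C * ENNReal.ofReal (majorant η.ofLp)

/-- The single layer formed by the translates of the scaling function. -/
def scalingLayer (c C : ℝ) (Φ : R3 → ℂ) : Layer (Fin 3) where
  sampling _ := c
  dual := LinearMap.id
  window := Φ
  envelope _ := ENNReal.ofReal C

variable {α c₁ c₂ c₀ C A : ℝ} {W Φ : R3 → ℂ} {P : Matrix (Fin 3) (Fin 3) ℝ}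

theorem enorm_sq_eq_ofReal (z : ℂ) : ‖z‖ₑ ^ 2 = ENNReal.ofReal (‖z‖ ^ 2) := by
  rw [ENNReal.ofReal_pow (norm_nonneg _), ofReal_norm]

theorem abs_det_eq_one_of_transpose_mul (hP : P.transpose * P = 1) : |P.det| = 1 := by
  have hdet := congrArg Matrix.det hP
  rw [Matrix.det_mul, Matrix.det_transpose, Matrix.det_one] at hdet
  rw [← pow_eq_one_iff_of_nonneg (abs_nonneg _) two_ne_zero, sq_abs, sq, hdet]

theorem abs_det_dual_shearLayer (hP : P.transpose * P = 1) (p : ShearParam α) :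
    |(shearLayer α c₁ c₂ C W P p).dual.det| = (((2 : ℝ) ^ (p.1.1 * (α + 2) / 4)) ^ 2)⁻¹ := by
  rw [shearLayer, LinearMap.det_comp, LinearMap.det_toLpLin, LinearMap.det_toLpLin, abs_mul,
    abs_det_eq_one_of_transpose_mul hP, mul_one, det_dualMat, abs_of_pos (by positivity)]

theorem isDominated_shearLayer (hW : IsShearletWindow α C A W) (hP : P.transpose * P = 1)
    (h₀ : 0 < c₂) (h₂₁ : c₂ ≤ c₁) (h₁ : c₁ ≤ c₀) (hc₀ : c₀ ≤ 1) (p : ShearParam α) :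
    (shearLayer α c₁ c₂ C W P p).IsDominated c₀ where
  det_ne_zero := by
    rw [← abs_pos, abs_det_dual_shearLayer hP]
    positivity
  sampling_pos i := by
    fin_cases i
    exacts [h₀.trans_le h₂₁, h₀, h₀]
  sampling_le i := by
    fin_cases i
    exacts [h₁, h₂₁.trans h₁, h₂₁.trans h₁]
  pos := by linarith
  le_one := hc₀
  memLp_window := hW.memLp
  measurable_envelope := by
    unfold shearLayer majorant decay
    fun_prop
  window_le η := by
    have hprod : 0 ≤ ∏ i, decay (η i) := Finset.prod_nonneg fun i _ => (decay_pos _).le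
    calc ‖W η‖ₑ ^ 2 ≤ ENNReal.ofReal (C * majorant η.ofLp * ∏ i, decay (η i)) :=
          (enorm_sq_eq_ofReal _).trans_le (ENNReal.ofReal_le_ofReal (hW.norm_sq_le η))
      _ = _ := by rw [ENNReal.ofReal_mul' hprod, ENNReal.ofReal_mul' (majorant_nonneg _)]; rfl

theorem isDominated_scalingLayer (hΦ : IsScalingWindow α C A Φ) (h₀ : 0 < c₁) (h₁ : c₁ ≤ c₀)
    (hc₀ : c₀ ≤ 1) : (scalingLayer c₁ C Φ).IsDominated c₀ where
  det_ne_zero := by simp [scalingLayer]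
  sampling_pos _ := h₀
  sampling_le _ := h₁
  pos := h₀.trans_le h₁
  le_one := hc₀
  memLp_window := hΦ.memLp
  measurable_envelope := measurable_const
  window_le η := by
    rw [enorm_sq_eq_ofReal, scalingLayer,
      ← ENNReal.ofReal_mul' (Finset.prod_nonneg fun i _ => (decay_pos _).le)]
    exact ENNReal.ofReal_le_ofReal (hΦ.norm_sq_le η)

/-- A bound for the sum of the envelopes of all the layers of a shearlet system. -/
def shearBound (α C : ℝ) : ℝ≥0∞ :=
  ENNReal.ofReal C * (ENNReal.ofReal (1 - ((2 : ℝ) ^ (-(α / 2))) ^ 2)⁻¹ * decaySum ^ 2)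

theorem shearBound_ne_top : shearBound α C ≠ ∞ := by
  have := decaySum_ne_top
  unfold shearBound
  finiteness

theorem tsum_envelope_shearLayer_le (hα : 0 < α) (ξ : R3) :
    ∑' p, (shearLayer α c₁ c₂ C W P p).envelope ((shearLayer α c₁ c₂ C W P p).dual ξ) ≤
      shearBound α C := by
  have hρ : ((2 : ℝ) ^ (-(α / 2))) ^ 2 < 1 :=
    pow_lt_one₀ (by positivity) (Real.rpow_lt_one_of_one_lt_of_neg one_lt_two (by linarith))
      two_ne_zero
  simp only [shearLayer, LinearMap.comp_apply, ofLp_toEuclideanLin_dualMat, shearBound]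
  rw [ENNReal.tsum_mul_left]
  gcongr
  exact (ENNReal.tsum_comp_le_tsum_of_injective Subtype.val_injective _).trans
    (tsum_majorant_le hρ (fun j => ((2 : ℝ) ^ ((j : ℝ) / 2))⁻¹) _ _ _)

theorem exists_covers_shearLayer (hα : 0 < α) (hW : IsShearletWindow α C A W)
    (hℓ : ∀ p, (shearLayer α c₁ c₂ C W P p).IsDominated c₀) {ξ : R3}
    (hξ : Matrix.toEuclideanLin P ξ ∈ cone α) :
    ∃ p, (shearLayer α c₁ c₂ C W P p).Covers (ENNReal.ofReal A) ξ := by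
  obtain ⟨p, hp, hp₀, hp₁, hp₂⟩ := exists_shearParam hα hξ
  refine ⟨p, (hℓ p).covers (fun i => ?_) ?_⟩
  · fin_cases i
    exacts [hp₀.trans_lt (by norm_num), hp₁.trans_lt (by norm_num), hp₂.trans_lt (by norm_num)]
  · rw [enorm_sq_eq_ofReal]
    exact ENNReal.ofReal_le_ofReal (hW.le_norm_sq _ hp hp₀ hp₁ hp₂)

theorem covers_scalingLayer (hα : 0 ≤ α) (hΦ : IsScalingWindow α C A Φ)
    (hℓ : (scalingLayer c₁ C Φ).IsDominated c₀) {ξ : R3} (hξ : ∀ i, |ξ i| ≤ innerRadius α) :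
    (scalingLayer c₁ C Φ).Covers (ENNReal.ofReal A) ξ := by
  refine hℓ.covers (fun i => (hξ i).trans_lt ?_) ?_
  · linarith [innerRadius_le hα]
  · rw [enorm_sq_eq_ofReal]
    exact ENNReal.ofReal_le_ofReal (hΦ.le_norm_sq _ hξ)

end PyramidLayers

section ShearletSystems

variable {α c₁ c₂ C A : ℝ} {ψ W φ Φ : R3 → ℂ} {P : Matrix (Fin 3) (Fin 3) ℝ}

theorem inner_toEuclideanLin_of_transpose_mul {d : Type*} [Fintype d] [DecidableEq d]
    {M N : Matrix d d ℝ} (h : M.transpose * N = 1) (ξ x : EuclideanSpace ℝ d) :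
    ⟪Matrix.toEuclideanLin N ξ, Matrix.toEuclideanLin M x⟫ = ⟪ξ, x⟫ := by
  have hadj : Matrix.toEuclideanLin M.transpose = (Matrix.toEuclideanLin M).adjoint := by
    rw [← Matrix.toEuclideanLin_conjTranspose_eq_adjoint,
      Matrix.conjTranspose_eq_transpose_of_trivial]
  rw [← LinearMap.adjoint_inner_left, ← hadj, ← LinearMap.comp_apply, ← Matrix.toLpLin_mul_same, h,
    Matrix.toLpLin_one, LinearMap.id_apply]

theorem shear₁_mul_scale₁ (α : ℝ) (j : ℕ) (k : ℤ × ℤ) : shear₁ k * scale₁ α j =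
    !![(2 : ℝ) ^ (j * α / 2), k.1 * (2 : ℝ) ^ ((j : ℝ) / 2), k.2 * (2 : ℝ) ^ ((j : ℝ) / 2);
      0, (2 : ℝ) ^ ((j : ℝ) / 2), 0; 0, 0, (2 : ℝ) ^ ((j : ℝ) / 2)] := by
  ext i l
  rw [scale₁, Matrix.mul_diagonal]
  fin_cases i <;> fin_cases l <;> simp [shear₁]

theorem shear₂_mul_scale₂ (α : ℝ) (j : ℕ) (k : ℤ × ℤ) : shear₂ k * scale₂ α j =
    !![(2 : ℝ) ^ ((j : ℝ) / 2), 0, 0;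
      k.1 * (2 : ℝ) ^ ((j : ℝ) / 2), (2 : ℝ) ^ (j * α / 2), k.2 * (2 : ℝ) ^ ((j : ℝ) / 2);
      0, 0, (2 : ℝ) ^ ((j : ℝ) / 2)] := by
  ext i l
  rw [scale₂, Matrix.mul_diagonal]
  fin_cases i <;> fin_cases l <;> simp [shear₂]

theorem shear₃_mul_scale₃ (α : ℝ) (j : ℕ) (k : ℤ × ℤ) : shear₃ k * scale₃ α j =
    !![(2 : ℝ) ^ ((j : ℝ) / 2), 0, 0; 0, (2 : ℝ) ^ ((j : ℝ) / 2), 0;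
      k.1 * (2 : ℝ) ^ ((j : ℝ) / 2), k.2 * (2 : ℝ) ^ ((j : ℝ) / 2), (2 : ℝ) ^ (j * α / 2)] := by
  ext i l
  rw [scale₃, Matrix.mul_diagonal]
  fin_cases i <;> fin_cases l <;> simp [shear₃]

theorem transpose_shear₁_mul_scale₁_mul_dualMat (α : ℝ) (p : ℕ × ℤ × ℤ) :
    (shear₁ p.2 * scale₁ α p.1).transpose * dualMat α p = 1 := by
  have ha : (2 : ℝ) ^ (p.1 * α / 2) ≠ 0 := by positivity
  have hb : (2 : ℝ) ^ ((p.1 : ℝ) / 2) ≠ 0 := by positivity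
  rw [shear₁_mul_scale₁, dualMat]
  generalize (2 : ℝ) ^ (p.1 * α / 2) = a at *
  generalize (2 : ℝ) ^ ((p.1 : ℝ) / 2) = b at *
  ext i j
  fin_cases i <;> fin_cases j <;>
    simp [Matrix.mul_apply, Fin.sum_univ_three, ha, hb] <;> ring

/-- The indices of the first system as pairs of a scale and shear parameter and a translation. -/
def indexEquiv₁ (α : ℝ) : ShearParam α × (Fin 3 → ℤ) ≃ ShearIndex α where
  toFun q := Subtype.mk (q.1.1.1, q.1.1.2, q.2) q.1.2
  invFun q := (⟨(q.1.1, q.1.2.1), q.2⟩, q.1.2.2)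
  left_inv _ := rfl
  right_inv _ := rfl

/-- The indices of the second system, with the first two translation parameters exchanged so that
`perm12` turns the second system into the first. -/
def indexEquiv₂ (α : ℝ) : ShearParam α × (Fin 3 → ℤ) ≃ ShearIndex α where
  toFun q := Subtype.mk (q.1.1.1, q.1.1.2, ![q.2 1, q.2 0, q.2 2]) q.1.2
  invFun q := (⟨(q.1.1, q.1.2.1), q.2⟩, ![q.1.2.2 1, q.1.2.2 0, q.1.2.2 2])
  left_inv q := by
    refine Prod.ext rfl (funext fun i => ?_)
    fin_cases i <;> rfl
  right_inv q := by
    refine Subtype.ext (Prod.ext rfl (Prod.ext rfl (funext fun i => ?_)))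
    fin_cases i <;> rfl

/-- The indices of the third system, with the shear parameters and the outer translation
parameters exchanged so that `perm13` turns the third system into the first. -/
def indexEquiv₃ (α : ℝ) : ShearParam α × (Fin 3 → ℤ) ≃ ShearIndex α where
  toFun q := Subtype.mk (q.1.1.1, (q.1.1.2.2, q.1.1.2.1), ![q.2 2, q.2 1, q.2 0]) q.1.2.symm
  invFun q := (⟨(q.1.1, (q.1.2.1.2, q.1.2.1.1)), q.2.symm⟩, ![q.1.2.2 2, q.1.2.2 1, q.1.2.2 0])
  left_inv q := by
    refine Prod.ext rfl (funext fun i => ?_)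
    fin_cases i <;> rfl
  right_inv q := by
    refine Subtype.ext (Prod.ext rfl (Prod.ext rfl (funext fun i => ?_)))
    fin_cases i <;> rfl

instance countable_shearIndex (α : ℝ) : Countable (ShearIndex α) :=
  (indexEquiv₁ α).symm.countable_iff.2 inferInstance

/-- The function with scale and shear `p` and translation `m` in the first shearlet system, after
the change of coordinates `P`. -/
def shearAtom (α c₁ c₂ : ℝ) (ψ : R3 → ℂ) (P : Matrix (Fin 3) (Fin 3) ℝ) (p : ShearParam α)
    (m : Fin 3 → ℤ) (x : R3) : ℂ :=
  ((2 ^ (p.1.1 * (α + 2) / 4) : ℝ) : ℂ) *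
    ψ (Matrix.toEuclideanLin (shear₁ p.1.2 * scale₁ α p.1.1) (Matrix.toEuclideanLin P x) -
      Matrix.toEuclideanLin (sample₁ c₁ c₂) (latticePoint m))

theorem shear₁System_indexEquiv₁ (p : ShearParam α) (m : Fin 3 → ℤ) (x : R3) :
    shear₁System α c₁ c₂ ψ (indexEquiv₁ α (p, m)) x = shearAtom α c₁ c₂ ψ 1 p m x := by
  rw [shearAtom, Matrix.toLpLin_one]
  rfl

theorem shear₂System_indexEquiv₂ (p : ShearParam α) (m : Fin 3 → ℤ) (x : R3) :
    shear₂System α c₁ c₂ (swap12 ψ) (indexEquiv₂ α (p, m)) x =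
      shearAtom α c₁ c₂ ψ perm12 p m x := by
  change ((2 ^ (p.1.1 * (α + 2) / 4) : ℝ) : ℂ) * swap12 ψ (WithLp.toLp 2
    ((shear₂ p.1.2 * scale₂ α p.1.1).mulVec x.ofLp -
      (sample₂ c₁ c₂).mulVec (fun i => ((![m 1, m 0, m 2] : Fin 3 → ℤ) i : ℝ)))) = _
  rw [shearAtom, toEuclideanLin_perm12, shear₁_mul_scale₁, shear₂_mul_scale₂, swap12]
  congr 2
  ext i
  fin_cases i <;> simp [sample₁, sample₂, latticePoint, Matrix.mulVec, dotProduct,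
    Matrix.diagonal, Fin.sum_univ_three] <;> ring

theorem shear₃System_indexEquiv₃ (p : ShearParam α) (m : Fin 3 → ℤ) (x : R3) :
    shear₃System α c₁ c₂ (swap13 ψ) (indexEquiv₃ α (p, m)) x =
      shearAtom α c₁ c₂ ψ perm13 p m x := by
  change ((2 ^ (p.1.1 * (α + 2) / 4) : ℝ) : ℂ) * swap13 ψ (WithLp.toLp 2
    ((shear₃ (p.1.2.2, p.1.2.1) * scale₃ α p.1.1).mulVec x.ofLp -
      (sample₃ c₁ c₂).mulVec (fun i => ((![m 2, m 1, m 0] : Fin 3 → ℤ) i : ℝ)))) = _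
  rw [shearAtom, toEuclideanLin_perm13, shear₁_mul_scale₁, shear₃_mul_scale₃, swap13]
  congr 2
  ext i
  fin_cases i <;> simp [sample₁, sample₃, latticePoint, Matrix.mulVec, dotProduct,
    Matrix.diagonal, Fin.sum_univ_three] <;> ring

theorem hasLayers_shearLayer (hψ : HasL2Fourier ψ W) (hW : IsShearletWindow α C A W)
    (hP : P.transpose * P = 1) {g : ShearIndex α → R3 → ℂ}
    (e : ShearParam α × (Fin 3 → ℤ) ≃ ShearIndex α)
    (hg : ∀ p m x, g (e (p, m)) x = shearAtom α c₁ c₂ ψ P p m x) :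
    HasLayers g (shearLayer α c₁ c₂ C W P) := by
  refine hasLayers_of_equiv (fun _ => hψ) (fun _ => hW.integrable) (fun _ => hW.memLp)
    (B := fun p => Matrix.toEuclideanLin (shear₁ p.1.2 * scale₁ α p.1.1) ∘ₗ
      Matrix.toEuclideanLin P) (fun p ξ x => ?_) (fun p => ?_) e hg
  · exact (inner_toEuclideanLin_of_transpose_mul
      (transpose_shear₁_mul_scale₁_mul_dualMat α p) _ _).trans
      (inner_toEuclideanLin_of_transpose_mul hP _ _)
  · have hpos : 0 < (2 : ℝ) ^ (p.1.1 * (α + 2) / 4) := by positivity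
    rw [abs_det_dual_shearLayer hP, enorm_sq_eq_ofReal, Complex.norm_real,
      Real.norm_of_nonneg hpos.le, ← ENNReal.ofReal_mul (by positivity),
      mul_inv_cancel₀ (by positivity), ENNReal.ofReal_one]

theorem hasLayers_scalingSystem (hφ : HasL2Fourier φ Φ) (hΦ : IsScalingWindow α C A Φ) (c : ℝ) :
    HasLayers (scalingSystem c φ) fun _ : Unit => scalingLayer c C Φ := by
  refine hasLayers_of_equiv (fun _ => hφ) (fun _ => hΦ.integrable) (fun _ => hΦ.memLp)
    (B := fun _ => LinearMap.id) (a := fun _ => 1) (fun _ _ _ => rfl) (fun _ => ?_)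
    (Equiv.uniqueProd _ _) fun _ m x => ?_
  · simp [scalingLayer]
  · rw [one_mul, scalingSystem]
    congr 1
    ext i
    simp [scalingLayer, Layer.translation, latticePoint]

end ShearletSystems

/-! ### The shearlet frames -/

section Frames

variable {α c₁ c₂ C C' A A' : ℝ} {ψ W φ Φ : R3 → ℂ}

theorem ofReal_cube_le_prod_sampling_shearLayer {P : Matrix (Fin 3) (Fin 3) ℝ}
    (h₂₁ : c₂ ≤ c₁) (p : ShearParam α) :
    ENNReal.ofReal (c₂ ^ 3) ≤ ENNReal.ofReal (∏ i, (shearLayer α c₁ c₂ C W P p).sampling i) := by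
  refine ENNReal.ofReal_le_ofReal ?_
  simp only [shearLayer, Fin.prod_univ_three, Matrix.cons_val]
  nlinarith [mul_le_mul_of_nonneg_right h₂₁ (sq_nonneg c₂)]

theorem exists_isL2FrameOn_shear₁System (hα : 0 < α) (hA : 0 < A)
    (hW : IsShearletWindow α C A W) (hψ : HasL2Fourier ψ W) :
    ∃ ĉ₁ : ℝ, 0 < ĉ₁ ∧ ∀ c₁ c₂ : ℝ, 0 < c₂ → c₂ ≤ c₁ → c₁ ≤ ĉ₁ →
      IsL2FrameOn L2Pyramid (shear₁System α c₁ c₂ ψ) := by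
  have hA' : ENNReal.ofReal A ≠ 0 := (ENNReal.ofReal_pos.2 hA).ne'
  obtain ⟨ĉ₁, hpos, hle, hsmall⟩ := exists_ofReal_sq_mul_le
    (ENNReal.mul_ne_top (tsum_latticeWeight_ne_top (d := Fin 3))
      (shearBound_ne_top (α := α) (C := C))) hA'
  refine ⟨ĉ₁, hpos, fun c₁ c₂ h₀ h₂₁ h₁ => ?_⟩
  have hone : (1 : Matrix (Fin 3) (Fin 3) ℝ).transpose * 1 = 1 := by simp
  have hℓ := isDominated_shearLayer hW hone h₀ h₂₁ h₁ hle
  refine isL2FrameOn_of_hasLayers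
    (hasLayers_shearLayer hψ hW hone (indexEquiv₁ α) shear₁System_indexEquiv₁) hℓ
    shearBound_ne_top (tsum_envelope_shearLayer_le hα) hA' ENNReal.ofReal_ne_top hsmall
    (v := ENNReal.ofReal (c₂ ^ 3)) (ENNReal.ofReal_pos.2 (by positivity)).ne'
    (ofReal_cube_le_prod_sampling_shearLayer h₂₁) fun f hf => ?_
  filter_upwards [hf] with ξ hξ hne
  refine exists_covers_shearLayer hα hW hℓ ?_
  rw [Matrix.toLpLin_one]
  exact pyramid_subset_cone hα.le (not_not.1 (mt hξ hne))

/-- The layers of the scaling functions and of the three shearlet systems. -/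
def pyramidLayers (α c₁ c₂ C C' : ℝ) (W Φ : R3 → ℂ) :
    Unit ⊕ ShearParam α ⊕ ShearParam α ⊕ ShearParam α → Layer (Fin 3) :=
  Sum.elim (fun _ => scalingLayer c₁ C' Φ)
    (Sum.elim (shearLayer α c₁ c₂ C W 1)
      (Sum.elim (shearLayer α c₁ c₂ C W perm12) (shearLayer α c₁ c₂ C W perm13)))

theorem hasLayers_pyramidSystem (hW : IsShearletWindow α C A W) (hΦ : IsScalingWindow α C' A' Φ)
    (hψ : HasL2Fourier ψ W) (hφ : HasL2Fourier φ Φ) :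
    HasLayers (pyramidSystem α c₁ c₂ φ ψ (swap12 ψ) (swap13 ψ))
      (pyramidLayers α c₁ c₂ C C' W Φ) :=
  (hasLayers_scalingSystem hφ hΦ c₁).sumElim <|
    (hasLayers_shearLayer hψ hW (by simp) (indexEquiv₁ α) shear₁System_indexEquiv₁).sumElim <|
      (hasLayers_shearLayer hψ hW transpose_perm12_mul (indexEquiv₂ α)
        shear₂System_indexEquiv₂).sumElim <|
          hasLayers_shearLayer hψ hW transpose_perm13_mul (indexEquiv₃ α) shear₃System_indexEquiv₃

theorem isDominated_pyramidLayers {c₀ : ℝ} (hW : IsShearletWindow α C A W)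
    (hΦ : IsScalingWindow α C' A' Φ) (h₀ : 0 < c₂) (h₂₁ : c₂ ≤ c₁) (h₁ : c₁ ≤ c₀) (hc₀ : c₀ ≤ 1) :
    ∀ p, (pyramidLayers α c₁ c₂ C C' W Φ p).IsDominated c₀
  | .inl _ => isDominated_scalingLayer hΦ (h₀.trans_le h₂₁) h₁ hc₀
  | .inr (.inl p) => isDominated_shearLayer hW (by simp) h₀ h₂₁ h₁ hc₀ p
  | .inr (.inr (.inl p)) => isDominated_shearLayer hW transpose_perm12_mul h₀ h₂₁ h₁ hc₀ p
  | .inr (.inr (.inr p)) => isDominated_shearLayer hW transpose_perm13_mul h₀ h₂₁ h₁ hc₀ p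

theorem ofReal_cube_le_prod_sampling_pyramidLayers (h₀ : 0 < c₂) (h₂₁ : c₂ ≤ c₁) : ∀ p,
    ENNReal.ofReal (c₂ ^ 3) ≤
      ENNReal.ofReal (∏ i, (pyramidLayers α c₁ c₂ C C' W Φ p).sampling i)
  | .inl _ => by
    simp only [pyramidLayers, scalingLayer, Sum.elim_inl, Finset.prod_const, Finset.card_univ,
      Fintype.card_fin]
    gcongr
  | .inr (.inl p) | .inr (.inr (.inl p)) | .inr (.inr (.inr p)) =>
    ofReal_cube_le_prod_sampling_shearLayer h₂₁ p

theorem tsum_envelope_pyramidLayers_le (hα : 0 < α) (ξ : R3) :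
    ∑' p, (pyramidLayers α c₁ c₂ C C' W Φ p).envelope
        ((pyramidLayers α c₁ c₂ C C' W Φ p).dual ξ) ≤
      ENNReal.ofReal C' + (shearBound α C + (shearBound α C + shearBound α C)) := by
  rw [Summable.tsum_sum ENNReal.summable ENNReal.summable,
    Summable.tsum_sum ENNReal.summable ENNReal.summable,
    Summable.tsum_sum ENNReal.summable ENNReal.summable]
  refine add_le_add ?_ (add_le_add (tsum_envelope_shearLayer_le hα ξ)
    (add_le_add (tsum_envelope_shearLayer_le hα ξ) (tsum_envelope_shearLayer_le hα ξ)))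
  rw [tsum_fintype]
  simp [pyramidLayers, scalingLayer]

theorem exists_covers_pyramidLayers {c₀ : ℝ} (hα : 0 < α) (hW : IsShearletWindow α C A W)
    (hΦ : IsScalingWindow α C' A' Φ)
    (hℓ : ∀ p, (pyramidLayers α c₁ c₂ C C' W Φ p).IsDominated c₀) (ξ : R3) :
    ∃ p, (pyramidLayers α c₁ c₂ C C' W Φ p).Covers (ENNReal.ofReal (min A A')) ξ := by
  have hle : ENNReal.ofReal (min A A') ≤ ENNReal.ofReal A :=
    ENNReal.ofReal_le_ofReal (min_le_left _ _)
  have hle' : ENNReal.ofReal (min A A') ≤ ENNReal.ofReal A' :=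
    ENNReal.ofReal_le_ofReal (min_le_right _ _)
  rcases mem_box_or_cones α ξ with hξ | hξ | hξ | hξ
  · exact ⟨.inl (), (covers_scalingLayer hα.le hΦ (hℓ (.inl ())) hξ).mono hle'⟩
  · obtain ⟨p, hp⟩ := exists_covers_shearLayer hα hW (fun p => hℓ (.inr (.inl p))) hξ
    exact ⟨.inr (.inl p), hp.mono hle⟩
  · obtain ⟨p, hp⟩ := exists_covers_shearLayer hα hW (fun p => hℓ (.inr (.inr (.inl p)))) hξ
    exact ⟨.inr (.inr (.inl p)), hp.mono hle⟩
  · obtain ⟨p, hp⟩ := exists_covers_shearLayer hα hW (fun p => hℓ (.inr (.inr (.inr p)))) hξ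
    exact ⟨.inr (.inr (.inr p)), hp.mono hle⟩

theorem exists_isL2Frame_pyramidSystem (hα : 0 < α) (hA : 0 < A) (hA' : 0 < A')
    (hW : IsShearletWindow α C A W) (hΦ : IsScalingWindow α C' A' Φ) (hψ : HasL2Fourier ψ W)
    (hφ : HasL2Fourier φ Φ) :
    ∃ ĉ₁ : ℝ, 0 < ĉ₁ ∧ ∀ c₁ c₂ : ℝ, 0 < c₂ → c₂ ≤ c₁ → c₁ ≤ ĉ₁ →
      IsL2Frame (pyramidSystem α c₁ c₂ φ ψ (swap12 ψ) (swap13 ψ)) := by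
  have hmin : ENNReal.ofReal (min A A') ≠ 0 := (ENNReal.ofReal_pos.2 (lt_min hA hA')).ne'
  have hR : ENNReal.ofReal C' + (shearBound α C + (shearBound α C + shearBound α C)) ≠ ∞ := by
    have := shearBound_ne_top (α := α) (C := C)
    finiteness
  obtain ⟨ĉ₁, hpos, hle, hsmall⟩ :=
    exists_ofReal_sq_mul_le (ENNReal.mul_ne_top (tsum_latticeWeight_ne_top (d := Fin 3)) hR) hmin
  refine ⟨ĉ₁, hpos, fun c₁ c₂ h₀ h₂₁ h₁ => ?_⟩
  have hℓ := isDominated_pyramidLayers hW hΦ h₀ h₂₁ h₁ hle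
  exact isL2FrameOn_of_hasLayers (hasLayers_pyramidSystem hW hΦ hψ hφ) hℓ hR
    (tsum_envelope_pyramidLayers_le hα) hmin ENNReal.ofReal_ne_top hsmall
    (v := ENNReal.ofReal (c₂ ^ 3)) (ENNReal.ofReal_pos.2 (by positivity)).ne'
    (ofReal_cube_le_prod_sampling_pyramidLayers h₀ h₂₁)
    fun f _ => .of_forall fun ξ _ => exists_covers_pyramidLayers hα hW hΦ hℓ ξ

variable {K L : ℕ} {m₀ m₁ : ℝ → ℂ}

theorem exists_isShearletWindow_shearletHat (α : ℝ) (hKL : L + 3 ≤ K) (hm₀ : IsLowPassFilter m₀)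
    (hm₁ : IsFilter m₁) (hm₀_sq : ∀ ξ : ℝ, ‖m₀ ξ‖ ^ 2 = lowPassSq K L ξ)
    (hm₁_sq : ∀ ξ : ℝ, ‖m₁ ξ‖ ^ 2 = ‖m₀ (ξ + 1 / 2)‖ ^ 2) :
    ∃ C A : ℝ, 0 < A ∧ IsShearletWindow α C A (shearletHat m₀ m₁) := by
  obtain ⟨C, -, hle⟩ := exists_norm_shearletHat_sq_le hm₀ hm₀_sq hm₁_sq hKL
  obtain ⟨A, hA, hge⟩ := exists_le_norm_shearletHat_sq hm₀ hm₀_sq hm₁_sq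
    (one_le_of_lowPassSq_eq hm₀ hm₀_sq) (innerRadius_pos α)
  exact ⟨C, A, hA, integrable_shearletHat hm₀ hm₁ hm₀_sq hm₁_sq hKL,
    memLp_shearletHat hm₀ hm₁ hm₀_sq hm₁_sq hKL, hle, hge⟩

theorem exists_isScalingWindow_tensorProd (hα : 0 ≤ α) (hKL : L + 3 ≤ K)
    (hm₀ : IsLowPassFilter m₀) (hm₀_sq : ∀ ξ : ℝ, ‖m₀ ξ‖ ^ 2 = lowPassSq K L ξ) :
    ∃ C A : ℝ, 0 < A ∧
      IsScalingWindow α C A (tensorProd fun _ : Fin 3 => scalingHat m₀) := by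
  have hmeas := measurable_scalingHat hm₀
  obtain ⟨C, hC, hle⟩ := exists_norm_scalingHat_le hm₀ hm₀_sq hKL
  refine ⟨∏ _i : Fin 3, C ^ 2, ∏ _i : Fin 3, ((2 / Real.pi) ^ 2) ^ K,
    Finset.prod_pos fun _ _ => by positivity,
    integrable_tensorProd fun _ => integrable_of_norm_le_decay hmeas hle,
    memLp_tensorProd (fun _ => hmeas) fun _ => memLp_two_of_norm_le_decay hmeas hle,
    fun η => ?_, fun η hη => ?_⟩
  · rw [tensorProd, norm_prod, ← Finset.prod_pow, ← Finset.prod_mul_distrib]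
    refine Finset.prod_le_prod (fun i _ => sq_nonneg _) fun i _ => ?_
    have hdecay := decay_pos (η i)
    calc ‖scalingHat m₀ (η i)‖ ^ 2 ≤ (C * decay (η i)) ^ 2 := by gcongr; exact hle _
      _ = C ^ 2 * decay (η i) * decay (η i) := by ring
      _ ≤ C ^ 2 * decay (η i) := mul_le_of_le_one_right (by positivity) (decay_le_one _)
  · rw [tensorProd, norm_prod, ← Finset.prod_pow]
    refine Finset.prod_le_prod (fun i _ => by positivity) fun i _ => ?_
    exact le_norm_scalingHat_sq hm₀ hm₀_sq (one_le_of_lowPassSq_eq hm₀ hm₀_sq)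
      (by linarith [hη i, innerRadius_le hα])

end Frames

end Shearlet

end

theorem mainTheorem6_general {α : ℝ} (hα : 0 < α) {K L : ℕ} (hKL : L + 3 ≤ K) {m₀ m₁ : ℝ → ℂ}
    (hm₀ : Shearlet.IsLowPassFilter m₀) (hm₁ : Shearlet.IsFilter m₁)
    (hm₀_sq : ∀ ξ : ℝ, ‖m₀ ξ‖ ^ 2 = Shearlet.lowPassSq K L ξ)
    (hm₁_sq : ∀ ξ : ℝ, ‖m₁ ξ‖ ^ 2 = ‖m₀ (ξ + 1 / 2)‖ ^ 2) :
    MemLp (Shearlet.scalingHat m₀) 2 volume ∧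
    MemLp (Shearlet.shearletHat m₀ m₁) 2 volume ∧
    ∀ (φ : ℝ → ℂ) (ψ : Shearlet.R3 → ℂ),
      Shearlet.HasL2Fourier φ (Shearlet.scalingHat m₀) →
      Shearlet.HasL2Fourier ψ (Shearlet.shearletHat m₀ m₁) →
      ∃ ĉ₁ : ℝ, 0 < ĉ₁ ∧ ∀ c₁ c₂ : ℝ, 0 < c₂ → c₂ ≤ c₁ → c₁ ≤ ĉ₁ →
        Shearlet.IsL2FrameOn Shearlet.L2Pyramid (Shearlet.shear₁System α c₁ c₂ ψ) ∧
        Shearlet.IsL2Frame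
          (Shearlet.pyramidSystem α c₁ c₂ (Shearlet.tensor3 φ) ψ
            (Shearlet.swap12 ψ) (Shearlet.swap13 ψ)) := by
  have hmeas := Shearlet.measurable_scalingHat hm₀
  obtain ⟨_, -, hdecay⟩ := Shearlet.exists_norm_scalingHat_le hm₀ hm₀_sq hKL
  have hmem := Shearlet.memLp_two_of_norm_le_decay hmeas hdecay
  obtain ⟨_, _, hA, hW⟩ :=
    Shearlet.exists_isShearletWindow_shearletHat α hKL hm₀ hm₁ hm₀_sq hm₁_sq
  obtain ⟨_, _, hA', hΦ⟩ := Shearlet.exists_isScalingWindow_tensorProd hα.le hKL hm₀ hm₀_sq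
  refine ⟨hmem, hW.memLp, fun φ ψ hφ hψ => ?_⟩
  have hφ₃ := Shearlet.hasL2Fourier_tensorProd (fun _ : Fin 3 => hφ) (fun _ => hmeas)
    (fun _ => Shearlet.integrable_of_norm_le_decay hmeas hdecay) (fun _ => hmem)
  rw [← Shearlet.tensor3_eq_tensorProd φ] at hφ₃
  obtain ⟨c, hc, hframe⟩ := Shearlet.exists_isL2FrameOn_shear₁System hα hA hW hψ
  obtain ⟨c', hc', hframe'⟩ := Shearlet.exists_isL2Frame_pyramidSystem hα hA hA' hW hΦ hψ hφ₃
  exact ⟨min c c', lt_min hc hc', fun c₁ c₂ h₀ h₂₁ h₁ =>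
    ⟨hframe c₁ c₂ h₀ h₂₁ (h₁.trans (min_le_left _ _)),
      hframe' c₁ c₂ h₀ h₂₁ (h₁.trans (min_le_right _ _))⟩⟩

theorem mainTheorem6 (α : ℝ) (hα : 1 < α) (hα' : α ≤ 2) (K L : ℕ) (hL : 10 ≤ L)
    (hKL : (3 * L : ℝ) / 2 ≤ K) (hKL' : (K : ℝ) ≤ 3 * L - 2) (m₀ m₁ : ℝ → ℂ)
    (hm₀ : Shearlet.IsLowPassFilter m₀) (hm₁ : Shearlet.IsFilter m₁)
    (hm₀_sq : ∀ ξ : ℝ, ‖m₀ ξ‖ ^ 2 = Shearlet.lowPassSq K L ξ)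
    (hm₁_sq : ∀ ξ : ℝ, ‖m₁ ξ‖ ^ 2 = ‖m₀ (ξ + 1 / 2)‖ ^ 2) :
    MemLp (Shearlet.scalingHat m₀) 2 volume ∧
    MemLp (Shearlet.shearletHat m₀ m₁) 2 volume ∧
    ∀ (φ : ℝ → ℂ) (ψ : Shearlet.R3 → ℂ),
      Shearlet.HasL2Fourier φ (Shearlet.scalingHat m₀) →
      Shearlet.HasL2Fourier ψ (Shearlet.shearletHat m₀ m₁) →
      ∃ ĉ₁ : ℝ, 0 < ĉ₁ ∧ ∀ c₁ c₂ : ℝ, 0 < c₂ → c₂ ≤ c₁ → c₁ ≤ ĉ₁ →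
        Shearlet.IsL2FrameOn Shearlet.L2Pyramid (Shearlet.shear₁System α c₁ c₂ ψ) ∧
        Shearlet.IsL2Frame
          (Shearlet.pyramidSystem α c₁ c₂ (Shearlet.tensor3 φ) ψ
            (Shearlet.swap12 ψ) (Shearlet.swap13 ψ)) := by
  have hKL₃ : 3 * L ≤ 2 * K := by exact_mod_cast (by linarith : (3 * L : ℝ) ≤ 2 * K)
  exact mainTheorem6_general (by linarith) (by omega) hm₀ hm₁ hm₀_sq hm₁_sq
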